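/- Let $k$ be an algebraically closed field of characteristic zero. **Definitions.** (i) A *datum* $\mathcal D=(G,\chi,a,\alpha)$ consists of a finite group $G$, a character $\chi\colon G\to k^\times$, a central element $a\in G$ with $\chi(a)\neq 1$, and $\alpha\in k$, such that $\alpha(a^n-1)=0$ in $k[G]$ or $\chi^n=1$, where $n>1$ is the order of $\chi(a)$. The Hopf algebra $H_{\mathcal D}$ is the $k$-algebra generated by $G$ and $x$ subject to the group relations of $G$, $x^n=\alpha(a^n-1)$ and $xg=\chi(g)gx$ for $g\in G$, with $\Delta(g)=g\otimes g$ and $\Delta(x)=x\otimes a+1\otimes x$ (so $\epsilon(g)=1$, $\epsilon(x)=0$, $S(g)=g^{-1}$, $S(x)=-xa^{-1}$). (ii) A *Hopf $q$-brace* $(H,\cdot,:)$ is a Hopf algebra $H$ with two bilinear operations $\cdot,:\,H\times H\to H$ such that, for all $h,l,m\in H$ (Sweedler notation): - $\epsilon(h\cdot l)=\epsilon(h:l)=\epsilon(h)\epsilon(l)$, and $H\otimes H^{\mathrm{cop}}\to H^{\mathrm{cop}}\otimes H$, $h\otimes l\mapsto l_{(1)}:h_{(2)}\otimes h_{(1)}\cdot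 l_{(2)}$ is a coalgebra morphism; - the maps $h\otimes l\mapsto h\cdot l_{(1)}\otimes l_{(2)}$ and $h\otimes l\mapsto h:l_{(2)}\otimes l_{(1)}$ of $H\otimes H$ are bijective; - $(h\cdot l_{(1)})\cdot(m:l_{(2)})=(h\cdot m_{(2)})\cdot(l\cdot m_{(1)})$, $(h\cdot l_{(1)}):(m\cdot l_{(2)})=(h:m_{(2)})\cdot(l:m_{(1)})$ and $(h:l_{(1)}):(m:l_{(2)})=(h:m_{(2)}):(l\cdot m_{(1)})$; - $h\cdot 1=h:1=h$, $h\cdot(lm)=(h\cdot m)\cdot l$ and $h:(lm)=(h:m):l$; - $hl\cdot m=(h\cdot(m_{(1)}:l_{(2)}))(l_{(1)}\cdot m_{(2)})$ and $hl:m=(h:(m_{(1)}\cdot l_{(2)}))(l_{(1)}:m_{(2)})$. (iii) A *$q$-brace* $(G,\cdot,:)$ is a group $G$ with two binary operations satisfying the same conditions with $g_{(1)}=g_{(2)}=g$: the maps $g\mapsto g\cdot h$ and $g\mapsto g:h$ are bijective for every $h$, and the last three groups of identities hold for elements of $G$. Products bind more tightly than $\cdot$ and $:$. **Theorem.** Let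 $\mathcal D=(G,\chi,a,\alpha)$ be a datum and let $(H_{\mathcal D},\cdot,:)$ be a Hopf $q$-brace with $x\cdot x\neq 0$ and $x:x\neq 0$. Then $n=2$; the operations restrict to a $q$-brace structure on $G$ such that $a\cdot g=a:g=a$ and $g\cdot a=g:a=g$ for all $g\in G$; 1. $\chi^2=1$, 2. $\chi(h)\chi(l:h)=\chi(l)\chi(h\cdot l)$ for all $h,l\in G$; and there is $\lambda_{10}\in k^\times$ such that, for all $h,g\in G$, $$hx\cdot g=\chi(g)(h\cdot g)x,\qquad hx:g=\chi(g)(h:g)x,$$ $$h\cdot gx=0,\qquad h:gx=0,$$ $$hx\cdot gx=\lambda_{10}(h\cdot g)(1-a),\qquad hx:gx=-\lambda_{10}(h:g)(1-a).$$ Conversely, let $\mathcal D=(G,\chi,a,\alpha)$ be a datum and let $(G,\cdot,:)$ be a $q$-brace such that $a\cdot g=a:g=a$ and $g\cdot a=g:a=g$ for all $g\in G$ and conditions 1 and 2 hold. Then for every $\lambda_{10}\in k^\times$ there is exactly one pair of bilinear operations on $H_{\mathcal D}$ which extend those of $G$ and satisfy the displayed formulas, and with these operations $H_{\mathcal D}$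 is a Hopf $q$-brace. -/

import Mathlib

open scoped TensorProduct

noncomputable section

/-! ### Rank one pointed Hopf algebras -/

namespace RankOne

universe u v

/-- A datum `(G, χ, a, α)`: a character `χ : G → kˣ`, a central element `a` such that
`χ(a) ≠ 1` (i.e. the order `n` of `χ(a)` is `> 1`), and a scalar `α` such that
`α(aⁿ - 1) = 0` in the group algebra (i.e. `α = 0` or `aⁿ = 1`), or `χⁿ = 1`. -/
structure Datum (k : Type u) (G : Type v) [Field k] [Group G] where
  chi : G →* kˣ
  a : G
  alpha : k
  central : a ∈ Subgroup.center G
  one_lt_n : 1 < orderOf (chi a)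
  compat : (alpha = 0 ∨ a ^ orderOf (chi a) = 1) ∨ chi ^ orderOf (chi a) = 1

/-- The generators of `H_D`: the elements of `G` and `x`. -/
inductive Gen (G : Type v) : Type v
  | grp (g : G) : Gen G
  | x : Gen G

variable {k : Type u} {G : Type v} [Field k] [Group G]

namespace Datum

/-- The order `n` of `χ(a)`. -/
def n (D : Datum k G) : ℕ := orderOf (D.chi D.a)

/-- The defining relations of `H_D` in the free algebra on `G ⊔ {x}`: the group relations of `G`,
`xⁿ = α(aⁿ - 1)` and `xg = χ(g)gx`. -/
inductive Rel (D : Datum k G) : FreeAlgebra k (Gen G) → FreeAlgebra k (Gen G) → Prop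
  | one : Rel D (FreeAlgebra.ι k (Gen.grp 1)) 1
  | mul (g h : G) : Rel D (FreeAlgebra.ι k (Gen.grp (g * h)))
      (FreeAlgebra.ι k (Gen.grp g) * FreeAlgebra.ι k (Gen.grp h))
  | x_pow : Rel D (FreeAlgebra.ι k Gen.x ^ D.n)
      (D.alpha • (FreeAlgebra.ι k (Gen.grp D.a) ^ D.n - 1))
  | x_mul (g : G) : Rel D (FreeAlgebra.ι k Gen.x * FreeAlgebra.ι k (Gen.grp g))
      ((D.chi g : k) • (FreeAlgebra.ι k (Gen.grp g) * FreeAlgebra.ι k Gen.x))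

/-- The algebra `H_D` generated by `G` and `x` subject to the above relations. -/
def H (D : Datum k G) : Type (max u v) := RingQuot D.Rel

instance (D : Datum k G) : Ring D.H := inferInstanceAs (Ring (RingQuot D.Rel))

instance (D : Datum k G) : Algebra k D.H := inferInstanceAs (Algebra k (RingQuot D.Rel))

/-- The quotient map from the free algebra. -/
def toH (D : Datum k G) : FreeAlgebra k (Gen G) →ₐ[k] D.H := RingQuot.mkAlgHom k D.Rel

/-- The canonical map `G → H_D`. -/
def of (D : Datum k G) : G →* D.H where
  toFun g := D.toH (FreeAlgebra.ι k (Gen.grp g))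
  map_one' := (RingQuot.mkAlgHom_rel k Rel.one).trans (map_one D.toH)
  map_mul' g h := (RingQuot.mkAlgHom_rel k (Rel.mul g h)).trans (map_mul D.toH _ _)

/-- The generator `x` of `H_D`. -/
def x (D : Datum k G) : D.H := D.toH (FreeAlgebra.ι k Gen.x)

theorem x_pow (D : Datum k G) : D.x ^ D.n = D.alpha • (D.of D.a ^ D.n - 1) := by
  have h : D.toH _ = D.toH _ := RingQuot.mkAlgHom_rel k (Rel.x_pow (D := D))
  rw [map_pow, map_smul, map_sub, map_pow, map_one] at h
  exact h

theorem x_mul (D : Datum k G) (g : G) : D.x * D.of g = (D.chi g : k) • (D.of g * D.x) := by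
  have h : D.toH _ = D.toH _ := RingQuot.mkAlgHom_rel k (Rel.x_mul (D := D) g)
  rw [map_mul, map_smul, map_mul] at h
  exact h

/-- The universal property of `H_D`. -/
def lift (D : Datum k G) {A : Type*} [Ring A] [Algebra k A] (f : G →* A) (y : A)
    (hy : y ^ D.n = D.alpha • (f D.a ^ D.n - 1))
    (hf : ∀ g, y * f g = (D.chi g : k) • (f g * y)) : D.H →ₐ[k] A :=
  RingQuot.liftAlgHom k
    ⟨FreeAlgebra.lift k (fun s => match s with
      | Gen.grp g => f g
      | Gen.x => y), by
      intro p q h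
      induction h with
      | one => simp
      | mul g h => simp
      | x_pow => simpa using hy
      | x_mul g => simpa using hf g⟩

section lift

variable (D : Datum k G) {A : Type*} [Ring A] [Algebra k A] (f : G →* A) (y : A)
    (hy : y ^ D.n = D.alpha • (f D.a ^ D.n - 1))
    (hf : ∀ g, y * f g = (D.chi g : k) • (f g * y))

@[simp]
theorem lift_of (g : G) : D.lift f y hy hf (D.of g) = f g :=
  (RingQuot.liftAlgHom_mkAlgHom_apply _ _ _ _).trans (by simp)

@[simp]
theorem lift_x : D.lift f y hy hf D.x = y :=
  (RingQuot.liftAlgHom_mkAlgHom_apply _ _ _ _).trans (by simp)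

end lift

theorem hom_ext (D : Datum k G) {A : Type*} [Ring A] [Algebra k A] {f g : D.H →ₐ[k] A}
    (h : ∀ s, f (D.of s) = g (D.of s)) (hx : f D.x = g D.x) : f = g := by
  refine RingQuot.ringQuot_ext' k f g (FreeAlgebra.hom_ext (funext fun s => ?_))
  cases s with
  | grp s => exact h s
  | x => exact hx

/-- The coefficients of the expansion of `(A + B)^m` for `BA = qAB`. -/
def qc (q : k) : ℕ → ℕ → k
  | 0, 0 => 1
  | 0, _ + 1 => 0
  | _ + 1, 0 => 1
  | m + 1, j + 1 => qc q m j + q ^ (j + 1) * qc q m (j + 1)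

theorem qc_zero (q : k) (m : ℕ) : qc q m 0 = 1 := by
  cases m <;> rfl

theorem qc_rec (q : k) (m : ℕ) : ∀ j, (1 - q ^ (j + 1)) * qc q (m + 1) (j + 1) =
    (1 - q ^ (m + 1)) * qc q m j := by
  induction m with
  | zero =>
    intro j
    cases j with
    | zero => simp [qc]
    | succ j => simp [qc]
  | succ m ih =>
    intro j
    have h1 : qc q (m + 2) (j + 1) = qc q (m + 1) j + q ^ (j + 1) * qc q (m + 1) (j + 1) := rfl
    rw [h1]
    cases j with
    | zero =>
      have h2 := ih 0
      rw [qc_zero] at *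
      linear_combination q ^ 1 * h2
    | succ j =>
      have h2 := ih (j + 1)
      have h3 := ih j
      have h4 : qc q (m + 1) (j + 1) = qc q m j + q ^ (j + 1) * qc q m (j + 1) := rfl
      linear_combination q ^ (j + 2) * h2 + q * h3 - q * (1 - q ^ (m + 1)) * h4

theorem qc_eq_zero (q : k) (m : ℕ) : ∀ j, m < j → qc q m j = 0 := by
  induction m with
  | zero => intro j hj; cases j with
    | zero => omega
    | succ j => rfl
  | succ m ih => intro j hj; cases j with
    | zero => omega
    | succ j => simp [qc, ih j (by omega), ih (j + 1) (by omega)]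

theorem qc_self (q : k) (m : ℕ) : qc q m m = 1 := by
  induction m with
  | zero => rfl
  | succ m ih => simp [qc, ih, qc_eq_zero q m (m + 1) (by omega)]

theorem q_add_pow {A : Type*} [Ring A] [Algebra k A] (q : k) (X Y : A)
    (h : Y * X = q • (X * Y)) (m : ℕ) :
    (X + Y) ^ m = ∑ j ∈ Finset.range (m + 1), qc q m j • (X ^ j * Y ^ (m - j)) := by
  have hYX : ∀ j, Y * X ^ j = q ^ j • (X ^ j * Y) := by
    intro j
    induction j with
    | zero => simp
    | succ j ih =>
      rw [pow_succ, ← mul_assoc, ih, smul_mul_assoc, mul_assoc, h, mul_smul_comm, smul_smul,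
        ← pow_succ, mul_assoc]
  induction m with
  | zero => simp [qc]
  | succ m ih =>
    rw [pow_succ', ih, add_mul, Finset.mul_sum, Finset.mul_sum, Finset.sum_range_succ' _ (m + 1)]
    have e1 : ∀ j ∈ Finset.range (m + 1), qc q (m + 1) (j + 1) • (X ^ (j + 1) * Y ^ (m + 1 - (j + 1)))
        = X * (qc q m j • (X ^ j * Y ^ (m - j)))
          + (q ^ (j + 1) * qc q m (j + 1)) • (X ^ (j + 1) * Y ^ (m - j)) := by
      intro j _
      rw [Nat.add_sub_add_right, mul_smul_comm, ← mul_assoc, ← pow_succ', ← add_smul]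
      rfl
    rw [Finset.sum_congr rfl e1, Finset.sum_add_distrib, add_assoc]
    congr 1
    have e2 : ∀ j ∈ Finset.range (m + 1), Y * (qc q m j • (X ^ j * Y ^ (m - j)))
        = (q ^ j * qc q m j) • (X ^ j * Y ^ (m + 1 - j)) := by
      intro j hj
      have hj' := Finset.mem_range.1 hj
      rw [mul_smul_comm, ← mul_assoc, hYX, smul_mul_assoc, mul_assoc, ← pow_succ', smul_smul,
        mul_comm (qc q m j), show m - j + 1 = m + 1 - j by omega]
    rw [Finset.sum_congr rfl e2, Finset.sum_range_succ' _ m,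
      Finset.sum_range_succ (fun j => (q ^ (j + 1) * qc q m (j + 1)) • (X ^ (j + 1) * Y ^ (m - j))) m,
      qc_eq_zero q m (m + 1) (by omega)]
    simp only [Nat.add_sub_add_right, mul_zero, zero_smul, add_zero, qc_zero, pow_zero, one_mul,
      Nat.sub_zero]

/-- If `BA = qAB` and `q` is a primitive `n`-th root of unity then `(A + B)ⁿ = Aⁿ + Bⁿ`. -/
theorem q_add_pow_of_primitive {A : Type*} [Ring A] [Algebra k A] {q : k} {n : ℕ}
    (hn : 0 < n) (hq : IsPrimitiveRoot q n) (X Y : A) (h : Y * X = q • (X * Y)) :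
    (X + Y) ^ n = X ^ n + Y ^ n := by
  obtain ⟨m, rfl⟩ : ∃ m, n = m + 1 := ⟨n - 1, by omega⟩
  rw [q_add_pow q X Y h, Finset.sum_range_succ, Finset.sum_range_succ', qc_self]
  rw [Finset.sum_eq_zero]
  · simp [qc, add_comm]
  · intro j hj
    have hj' := Finset.mem_range.1 hj
    have h1 := qc_rec q m j
    rw [hq.pow_eq_one, sub_self, zero_mul] at h1
    have h2 : (1 - q ^ (j + 1)) ≠ 0 := fun h3 =>
      hq.pow_ne_one_of_pos_of_lt (by omega) (by omega) (sub_eq_zero.1 h3).symm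
    rw [(mul_eq_zero.1 h1).resolve_left h2, zero_smul]

theorem isPrimitiveRoot (D : Datum k G) : IsPrimitiveRoot (D.chi D.a : k) D.n :=
  (IsPrimitiveRoot.coe_units_iff).2 (IsPrimitiveRoot.orderOf _)

theorem n_pos (D : Datum k G) : 0 < D.n := lt_trans one_pos D.one_lt_n

/-- `Δ(g) = g ⊗ g`. -/
def comulG (D : Datum k G) : G →* D.H ⊗[k] D.H where
  toFun g := D.of g ⊗ₜ D.of g
  map_one' := by rw [map_one]; rfl
  map_mul' g h := by rw [map_mul, Algebra.TensorProduct.tmul_mul_tmul]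

/-- The comultiplication of `H_D`: `Δ(g) = g ⊗ g` and `Δ(x) = x ⊗ a + 1 ⊗ x`. -/
def comulHom (D : Datum k G) : D.H →ₐ[k] D.H ⊗[k] D.H :=
  D.lift D.comulG (D.x ⊗ₜ D.of D.a + 1 ⊗ₜ D.x)
    (by
      rw [q_add_pow_of_primitive D.n_pos D.isPrimitiveRoot]
      · simp only [Algebra.TensorProduct.tmul_pow, one_pow, x_pow, comulG, MonoidHom.coe_mk,
          OneHom.coe_mk, ← TensorProduct.smul_tmul', TensorProduct.tmul_smul,
          TensorProduct.sub_tmul, TensorProduct.tmul_sub, Algebra.TensorProduct.one_def]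
        rw [← smul_add]
        congr 1
        abel
      · simp only [Algebra.TensorProduct.tmul_mul_tmul, one_mul, mul_one, x_mul,
          TensorProduct.tmul_smul])
    (by
      intro g
      have hc : D.of D.a * D.of g = D.of g * D.of D.a := by
        rw [← map_mul, ← map_mul, Subgroup.mem_center_iff.1 D.central g]
      simp only [comulG, MonoidHom.coe_mk, OneHom.coe_mk, add_mul, mul_add,
        Algebra.TensorProduct.tmul_mul_tmul, x_mul, hc, one_mul, mul_one, smul_add,
        TensorProduct.smul_tmul', TensorProduct.tmul_smul])

/-- The counit of `H_D`: `ε(g) = 1` and `ε(x) = 0`. -/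
def counitHom (D : Datum k G) : D.H →ₐ[k] k :=
  D.lift 1 0 (by simp [D.n_pos.ne']) (by simp)

@[simp]
theorem comulHom_of (D : Datum k G) (g : G) : D.comulHom (D.of g) = D.of g ⊗ₜ D.of g :=
  D.lift_of _ _ _ _ g

@[simp]
theorem comulHom_x (D : Datum k G) : D.comulHom D.x = D.x ⊗ₜ D.of D.a + 1 ⊗ₜ D.x :=
  D.lift_x _ _ _ _

@[simp]
theorem counitHom_of (D : Datum k G) (g : G) : D.counitHom (D.of g) = 1 :=
  D.lift_of _ _ _ _ g

@[simp]
theorem counitHom_x (D : Datum k G) : D.counitHom D.x = 0 :=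
  D.lift_x _ _ _ _

instance (D : Datum k G) : Bialgebra k D.H :=
  Bialgebra.ofAlgHom D.comulHom D.counitHom
    (D.hom_ext (by simp) (by
      simp [TensorProduct.add_tmul, TensorProduct.tmul_add, Algebra.TensorProduct.one_def,
        add_assoc]))
    (D.hom_ext (by simp) (by simp))
    (D.hom_ext (by simp) (by simp))

theorem comul_eq (D : Datum k G) (y : D.H) : Coalgebra.comul (R := k) y = D.comulHom y := rfl

theorem counit_eq (D : Datum k G) (y : D.H) : Coalgebra.counit (R := k) y = D.counitHom y := rfl

/-- `S(g) = g⁻¹`. -/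
def antipodeG (D : Datum k G) : G →* D.Hᵐᵒᵖ where
  toFun g := MulOpposite.op (D.of g⁻¹)
  map_one' := by simp
  map_mul' g h := by rw [← MulOpposite.op_mul, ← map_mul, mul_inv_rev]

theorem sign_aux (D : Datum k G) :
    (-1 : k) ^ D.n * (D.chi D.a : k) ^ (∑ i ∈ Finset.range D.n, i) = -1 := by
  have hq := D.isPrimitiveRoot
  have hn := D.n_pos
  rw [Finset.sum_range_id]
  rcases Nat.even_or_odd' D.n with ⟨m, hm | hm⟩
  · rw [hm] at hq hn ⊢
    have h1 : (D.chi D.a : k) ^ m = -1 := by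
      have h2 : ((D.chi D.a : k) ^ m) ^ 2 = 1 := by
        rw [← pow_mul, mul_comm, hq.pow_eq_one]
      rcases eq_or_eq_neg_of_sq_eq_sq _ _ (h2.trans (one_pow 2).symm) with h | h
      · exact absurd h (hq.pow_ne_one_of_pos_of_lt (by omega) (by omega))
      · exact h
    rw [show 2 * m * (2 * m - 1) / 2 = m * (2 * (m - 1) + 1) by
      rw [mul_assoc, Nat.mul_div_cancel_left _ two_pos]; congr 1; omega]
    rw [pow_mul, pow_mul, h1, neg_one_sq, one_pow, one_mul, pow_succ, pow_mul, neg_one_sq,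
      one_pow, one_mul]
  · rw [hm] at hq ⊢
    rw [show (2 * m + 1) * (2 * m + 1 - 1) / 2 = (2 * m + 1) * m by
      rw [Nat.add_sub_cancel, mul_left_comm, Nat.mul_div_cancel_left _ two_pos]]
    rw [pow_mul (D.chi D.a : k), hq.pow_eq_one, one_pow, mul_one, pow_succ, pow_mul, neg_one_sq,
      one_pow, one_mul]

theorem inv_mul_x (D : Datum k G) (g : G) :
    D.of g⁻¹ * D.x = (D.chi g : k) • (D.x * D.of g⁻¹) := by
  rw [x_mul, smul_smul, map_inv D.chi, ← Units.val_mul, mul_inv_cancel, Units.val_one, one_smul]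

theorem x_mul_pow (D : Datum k G) (m : ℕ) : (D.x * D.of D.a⁻¹) ^ m =
    (D.chi D.a : k) ^ (∑ i ∈ Finset.range m, i) • (D.x ^ m * D.of D.a⁻¹ ^ m) := by
  have h : ∀ j, D.of D.a⁻¹ * D.x ^ j = (D.chi D.a : k) ^ j • (D.x ^ j * D.of D.a⁻¹) := by
    intro j
    induction j with
    | zero => simp
    | succ j ih =>
      rw [pow_succ, ← mul_assoc, ih, smul_mul_assoc, mul_assoc, inv_mul_x, mul_smul_comm,
        smul_smul, ← pow_succ, mul_assoc]
  induction m with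
  | zero => simp
  | succ m ih =>
    rw [pow_succ', ih, mul_smul_comm, Finset.sum_range_succ, pow_add, mul_smul]
    congr 1
    rw [mul_assoc, ← mul_assoc (D.of D.a⁻¹), h, smul_mul_assoc, mul_smul_comm, pow_succ' D.x,
      pow_succ' (D.of D.a⁻¹)]
    simp only [mul_assoc]

/-- The antipode of `H_D` as an anti-homomorphism: `S(g) = g⁻¹` and `S(x) = -xa⁻¹`. -/
def antipodeHom (D : Datum k G) : D.H →ₐ[k] D.Hᵐᵒᵖ :=
  D.lift D.antipodeG (MulOpposite.op (-(D.x * D.of D.a⁻¹)))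
    (by
      have hb : D.of D.a ^ D.n * D.of D.a⁻¹ ^ D.n = 1 := by
        rw [← map_pow, ← map_pow, ← map_mul, inv_pow, mul_inv_cancel, map_one]
      have h1 : (-(D.x * D.of D.a⁻¹)) ^ D.n = D.alpha • (D.of D.a⁻¹ ^ D.n - 1) := by
        have h2 : (-(D.x * D.of D.a⁻¹)) = (-1 : k) • (D.x * D.of D.a⁻¹) := by simp
        rw [h2, smul_pow, x_mul_pow, smul_smul, sign_aux, x_pow, smul_mul_assoc, sub_mul, hb,
          one_mul, neg_one_smul, ← smul_neg, neg_sub]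
      rw [← MulOpposite.op_pow, h1]
      simp [antipodeG])
    (by
      intro g
      have hc : D.of D.a⁻¹ * D.of g⁻¹ = D.of g⁻¹ * D.of D.a⁻¹ := by
        rw [← map_mul, ← map_mul, ← mul_inv_rev, ← mul_inv_rev,
          Subgroup.mem_center_iff.1 D.central g]
      simp only [antipodeG, MonoidHom.coe_mk, OneHom.coe_mk, ← MulOpposite.op_mul,
        ← MulOpposite.op_smul]
      congr 1
      rw [mul_neg, neg_mul, smul_neg, mul_assoc, hc, ← mul_assoc, inv_mul_x, smul_mul_assoc,
        mul_assoc])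

/-- The antipode of `H_D`. -/
def antipodeMap (D : Datum k G) : D.H →ₗ[k] D.H :=
  (MulOpposite.opLinearEquiv k).symm.toLinearMap ∘ₗ D.antipodeHom.toLinearMap

@[simp]
theorem antipodeMap_of (D : Datum k G) (g : G) : D.antipodeMap (D.of g) = D.of g⁻¹ :=
  congrArg MulOpposite.unop (D.lift_of _ _ _ _ g)

@[simp]
theorem antipodeMap_x (D : Datum k G) : D.antipodeMap D.x = -(D.x * D.of D.a⁻¹) :=
  congrArg MulOpposite.unop (D.lift_x _ _ _ _)

theorem antipodeMap_mul (D : Datum k G) (y z : D.H) :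
    D.antipodeMap (y * z) = D.antipodeMap z * D.antipodeMap y :=
  congrArg MulOpposite.unop (map_mul D.antipodeHom y z)

theorem antipodeMap_one (D : Datum k G) : D.antipodeMap 1 = 1 :=
  congrArg MulOpposite.unop (map_one D.antipodeHom)

/-- `H_D` is generated as an algebra by `G` and `x`. -/
theorem induction (D : Datum k G) {P : D.H → Prop} (smul : ∀ (c : k) y, P y → P (c • y))
    (one : P 1) (of : ∀ g, P (D.of g)) (x : P D.x) (add : ∀ y z, P y → P z → P (y + z))
    (mul : ∀ y z, P y → P z → P (y * z)) (y : D.H) : P y := by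
  obtain ⟨w, rfl⟩ : ∃ w, D.toH w = y := RingQuot.mkAlgHom_surjective k D.Rel y
  induction w using FreeAlgebra.induction with
  | grade0 c =>
    rw [AlgHom.commutes, Algebra.algebraMap_eq_smul_one]
    exact smul c 1 one
  | grade1 s =>
    cases s with
    | grp g => exact of g
    | x => exact x
  | mul p q hp hq => rw [map_mul]; exact mul _ _ hp hq
  | add p q hp hq => rw [map_add]; exact add _ _ hp hq

theorem antipode_left (D : Datum k G) (y : D.H) :
    LinearMap.mul' k D.H (D.antipodeMap.rTensor D.H (D.comulHom y)) =
      algebraMap k D.H (D.counitHom y) := by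
  induction y using D.induction with
  | smul c y hy => simp only [map_smul, hy, smul_eq_mul, map_mul, ← Algebra.smul_def]
  | one => simp [Algebra.TensorProduct.one_def, antipodeMap_one]
  | of g => simp [← map_mul]
  | x => simp [antipodeMap_one, mul_assoc, ← map_mul]
  | add y z hy hz => simp only [map_add, hy, hz]
  | mul y z hy hz =>
    have key : ∀ t s : D.H ⊗[k] D.H, ∀ c : k,
        LinearMap.mul' k D.H (D.antipodeMap.rTensor D.H t) = algebraMap k D.H c →
        LinearMap.mul' k D.H (D.antipodeMap.rTensor D.H (t * s)) =
          c • LinearMap.mul' k D.H (D.antipodeMap.rTensor D.H s) := by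
      intro t s c ht
      induction s with
      | zero => simp
      | add s s' hs hs' => simp only [mul_add, map_add, hs, hs', smul_add]
      | tmul z z' =>
        have h1 : ∀ t : D.H ⊗[k] D.H,
            LinearMap.mul' k D.H (D.antipodeMap.rTensor D.H (t * z ⊗ₜ z')) =
            D.antipodeMap z * LinearMap.mul' k D.H (D.antipodeMap.rTensor D.H t) * z' := by
          intro t
          induction t with
          | zero => simp
          | add t t' ht ht' => simp only [add_mul, mul_add, map_add, ht, ht']
          | tmul y y' => simp [antipodeMap_mul, mul_assoc]
        rw [h1, ht, ← Algebra.commutes, mul_assoc, ← Algebra.smul_def]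
        simp
    rw [map_mul, key _ _ _ hy, hz, map_mul, map_mul, Algebra.smul_def]

theorem antipode_right (D : Datum k G) (y : D.H) :
    LinearMap.mul' k D.H (D.antipodeMap.lTensor D.H (D.comulHom y)) =
      algebraMap k D.H (D.counitHom y) := by
  induction y using D.induction with
  | smul c y hy => simp only [map_smul, hy, smul_eq_mul, map_mul, ← Algebra.smul_def]
  | one => simp [Algebra.TensorProduct.one_def, antipodeMap_one]
  | of g => simp [← map_mul]
  | x => simp
  | add y z hy hz => simp only [map_add, hy, hz]
  | mul y z hy hz =>
    have key : ∀ t s : D.H ⊗[k] D.H, ∀ c : k,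
        LinearMap.mul' k D.H (D.antipodeMap.lTensor D.H s) = algebraMap k D.H c →
        LinearMap.mul' k D.H (D.antipodeMap.lTensor D.H (t * s)) =
          c • LinearMap.mul' k D.H (D.antipodeMap.lTensor D.H t) := by
      intro t s c hs
      induction t with
      | zero => simp
      | add t t' ht ht' => simp only [add_mul, map_add, ht, ht', smul_add]
      | tmul y y' =>
        have h1 : ∀ s : D.H ⊗[k] D.H,
            LinearMap.mul' k D.H (D.antipodeMap.lTensor D.H (y ⊗ₜ y' * s)) =
            y * LinearMap.mul' k D.H (D.antipodeMap.lTensor D.H s) * D.antipodeMap y' := by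
          intro s
          induction s with
          | zero => simp
          | add s s' hs hs' => simp only [add_mul, mul_add, map_add, hs, hs']
          | tmul z z' => simp [antipodeMap_mul, mul_assoc]
        rw [h1, hs, ← Algebra.commutes, mul_assoc, ← Algebra.smul_def]
        simp
    rw [map_mul, key _ _ _ hz, hy, map_mul, map_mul, Algebra.smul_def, Algebra.commutes]

/-- The Hopf algebra `H_D`. -/
instance (D : Datum k G) : HopfAlgebra k D.H where
  antipode := D.antipodeMap
  mul_antipode_rTensor_comul := LinearMap.ext D.antipode_left
  mul_antipode_lTensor_comul := LinearMap.ext D.antipode_right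

end Datum

end RankOne

/-! ### Hopf `q`-braces -/

namespace HopfQBrace

open Coalgebra

section Coalg

variable {k X : Type*} [Field k] [AddCommGroup X] [Module k X] [Coalgebra k X]

variable (k X) in
/-- The comultiplication `x ↦ x₍₂₎ ⊗ x₍₁₎` of `X^cop`. -/
def comulCop : X →ₗ[k] X ⊗[k] X :=
  (TensorProduct.comm k X X).toLinearMap ∘ₗ comul

/-- Given comultiplications `δ₁` and `δ₂` on `X`, the corresponding comultiplication
`x ⊗ y ↦ (x₍₁₎ ⊗ y₍₁₎) ⊗ (x₍₂₎ ⊗ y₍₂₎)` of the tensor product of coalgebras. -/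
def comulTensor (δ₁ δ₂ : X →ₗ[k] X ⊗[k] X) :
    X ⊗[k] X →ₗ[k] (X ⊗[k] X) ⊗[k] (X ⊗[k] X) :=
  (TensorProduct.tensorTensorTensorComm k X X X X).toLinearMap ∘ₗ TensorProduct.map δ₁ δ₂

variable (k X) in
/-- The counit `ε ⊗ ε` of the tensor product. -/
def counitTensor : X ⊗[k] X →ₗ[k] k :=
  TensorProduct.lift ((LinearMap.mul k k).compl₁₂ counit counit)

/-- The map `h(x ⊗ y) = y₍₁₎ : x₍₂₎ ⊗ x₍₁₎ · y₍₂₎`, for bilinear operations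
`x · y = dot x y` and `x : y = col x y`. -/
def hMap (dot col : X →ₗ[k] X →ₗ[k] X) : X ⊗[k] X →ₗ[k] X ⊗[k] X :=
  TensorProduct.map (TensorProduct.lift col.flip) (TensorProduct.lift dot) ∘ₗ
    comulTensor (comulCop k X) comul

/-- The map `Ḡ(x ⊗ y) = x · y₍₁₎ ⊗ y₍₂₎`, with respect to a comultiplication `δ`. -/
def gMap (δ : X →ₗ[k] X ⊗[k] X) (dot : X →ₗ[k] X →ₗ[k] X) : X ⊗[k] X →ₗ[k] X ⊗[k] X :=
  (TensorProduct.lift dot).rTensor X ∘ₗ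
    (TensorProduct.assoc k X X X).symm.toLinearMap ∘ₗ δ.lTensor X

/-- `q`-magma coalgebras: the operations are compatible with the counit, and
`h : X ⊗ X^cop → X^cop ⊗ X` is a morphism of coalgebras. -/
structure IsQMagmaCoalgebra (dot col : X →ₗ[k] X →ₗ[k] X) : Prop where
  counit_dot : ∀ x y, counit (R := k) (dot x y) = counit (R := k) x * counit (R := k) y
  counit_col : ∀ x y, counit (R := k) (col x y) = counit (R := k) x * counit (R := k) y
  counit_hMap : counitTensor k X ∘ₗ hMap dot col = counitTensor k X
  comul_hMap : comulTensor (comulCop k X) comul ∘ₗ hMap dot col =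
    TensorProduct.map (hMap dot col) (hMap dot col) ∘ₗ comulTensor comul (comulCop k X)

/-- Left regularity: `Ḡ` is invertible. -/
def IsLeftRegular (dot : X →ₗ[k] X →ₗ[k] X) : Prop :=
  Function.Bijective (gMap comul dot)

/-- Right regularity: left regularity of the opposite `(X^cop, :, ·)`. -/
def IsRightRegular (col : X →ₗ[k] X →ₗ[k] X) : Prop :=
  Function.Bijective (gMap (comulCop k X) col)

/-- `q`-cycle coalgebras: left regular `q`-magma coalgebras such that
* `(u · v₍₁₎) · (w : v₍₂₎) = (u · w₍₂₎) · (v · w₍₁₎)`,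
* `(u · v₍₁₎) : (w · v₍₂₎) = (u : w₍₂₎) · (v : w₍₁₎)`,
* `(u : v₍₁₎) : (w : v₍₂₎) = (u : w₍₂₎) : (v · w₍₁₎)`.

Here `f.compl₁₂ g h` is the bilinear map `(y, z) ↦ f (g y) (h z)`, and
`TensorProduct.lift b (comul v)` is `b v₍₁₎ v₍₂₎`. -/
structure IsQCycleCoalgebra (dot col : X →ₗ[k] X →ₗ[k] X) : Prop
    extends IsQMagmaCoalgebra dot col where
  left_regular : IsLeftRegular dot
  cycle₁ : ∀ u v w, TensorProduct.lift (dot.compl₁₂ (dot u) (col w)) (comul v) =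
    TensorProduct.lift (dot.compl₁₂ (dot u) (dot v)) (comulCop k X w)
  cycle₂ : ∀ u v w, TensorProduct.lift (col.compl₁₂ (dot u) (dot w)) (comul v) =
    TensorProduct.lift (dot.compl₁₂ (col u) (col v)) (comulCop k X w)
  cycle₃ : ∀ u v w, TensorProduct.lift (col.compl₁₂ (col u) (col w)) (comul v) =
    TensorProduct.lift (col.compl₁₂ (col u) (dot v)) (comulCop k X w)

end Coalg

/-- Hopf `q`-braces: a Hopf algebra `H` with bilinear operations `·` and `:` making it a regular
`q`-cycle coalgebra, such that `H` is a right `H^op`-module via `·` and via `:`, and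
* `hk · l = (h · (l₍₁₎ : k₍₂₎))(k₍₁₎ · l₍₂₎)`,
* `hk : l = (h : (l₍₁₎ · k₍₂₎))(k₍₁₎ : l₍₂₎)`.

Here `hMap dot col (k ⊗ l) = l₍₁₎ : k₍₂₎ ⊗ k₍₁₎ · l₍₂₎`. -/
structure IsHopfQBrace {k H : Type*} [Field k] [Ring H] [HopfAlgebra k H]
    (dot col : H →ₗ[k] H →ₗ[k] H) : Prop extends IsQCycleCoalgebra dot col where
  right_regular : IsRightRegular col
  dot_one : ∀ h, dot h 1 = h
  dot_mul : ∀ h l m, dot h (l * m) = dot (dot h m) l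
  col_one : ∀ h, col h 1 = h
  col_mul : ∀ h l m, col h (l * m) = col (col h m) l
  mul_dot : ∀ h m l, dot (h * m) l =
    TensorProduct.lift ((LinearMap.mul k H).compl₁₂ (dot h) LinearMap.id)
      (hMap dot col (m ⊗ₜ l))
  mul_col : ∀ h m l, col (h * m) l =
    TensorProduct.lift ((LinearMap.mul k H).compl₁₂ (col h) LinearMap.id)
      (hMap col dot (m ⊗ₜ l))

/-- `q`-braces: a group with operations `·` and `:` making it a regular `q`-cycle set, such that
`G` is a right `G^op`-set via `·` and via `:`, and `hk · l = (h · (l : k))(k · l)`,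
`hk : l = (h : (l · k))(k : l)`. -/
structure IsQBrace {G : Type*} [Group G] (dot col : G → G → G) : Prop where
  left_regular : ∀ h, Function.Bijective (fun g => dot g h)
  right_regular : ∀ h, Function.Bijective (fun g => col g h)
  cycle₁ : ∀ u v w, dot (dot u v) (col w v) = dot (dot u w) (dot v w)
  cycle₂ : ∀ u v w, col (dot u v) (dot w v) = dot (col u w) (col v w)
  cycle₃ : ∀ u v w, col (col u v) (col w v) = col (col u w) (dot v w)
  dot_one : ∀ g, dot g 1 = g
  dot_mul : ∀ g h l, dot g (h * l) = dot (dot g l) h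
  col_one : ∀ g, col g 1 = g
  col_mul : ∀ g h l, col g (h * l) = col (col g l) h
  mul_dot : ∀ h m l, dot (h * m) l = dot h (col l m) * dot m l
  mul_col : ∀ h m l, col (h * m) l = col h (dot l m) * col m l

end HopfQBrace

namespace RankOne.Datum

/-- `·` and `:` on `H_D` extend the operations `dot` and `col` of `G`, and, for all `h, g ∈ G`,
* `hx · g = χ(g)(h · g)x` and `hx : g = χ(g)(h : g)x`,
* `h · gx = 0` and `h : gx = 0`,
* `hx · gx = lam (h · g)(1 - a)` and `hx : gx = -lam (h : g)(1 - a)`. -/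
structure Formulas {k G : Type*} [Field k] [Group G] (D : Datum k G) (dotG colG : G → G → G)
    (lam : k) (dot col : D.H →ₗ[k] D.H →ₗ[k] D.H) : Prop where
  dot_of : ∀ h g, dot (D.of h) (D.of g) = D.of (dotG h g)
  col_of : ∀ h g, col (D.of h) (D.of g) = D.of (colG h g)
  dot_x_of : ∀ h g, dot (D.of h * D.x) (D.of g) = (D.chi g : k) • (D.of (dotG h g) * D.x)
  col_x_of : ∀ h g, col (D.of h * D.x) (D.of g) = (D.chi g : k) • (D.of (colG h g) * D.x)
  dot_of_x : ∀ h g, dot (D.of h) (D.of g * D.x) = 0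
  col_of_x : ∀ h g, col (D.of h) (D.of g * D.x) = 0
  dot_x_x : ∀ h g, dot (D.of h * D.x) (D.of g * D.x) = lam • (D.of (dotG h g) * (1 - D.of D.a))
  col_x_x : ∀ h g, col (D.of h * D.x) (D.of g * D.x) = -(lam • (D.of (colG h g) * (1 - D.of D.a)))

end RankOne.Datum

end

/-! `H_D` has the basis g xⁱ with i < n, and in a Hopf q-brace both operations are coalgebra
morphisms from H ⊗ H^cop to H. In this basis the group-like elements are exactly those of G, and the
solutions of Δy = y ⊗ p + q ⊗ y are the multiples of p - q, together with the multiples of qx when p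
= qa (`exists_of_eq_of_comul`, `exists_of_skewPrimitive`). Hence the operations preserve G, and they
are nearly determined on x: x·g = u x + t(1 - a), x·x = m x + r(1 - a), and g·x is a combination of
g - g·a and (g·a)x.

The remaining scalars come from evaluating one expression in two ways. Acting on x by xg = χ(g)gx
gives m = 0 and u = χ(g) (`Restricts.exists_x_x`). The first two cycle identities at (x, x, x)
relate the scalars r of x·x and r' of x:x by r' = χ(a)r and r = χ(a)r', so χ(a) = -1, n = 2 and r' =
-r (`chi_a_and_scalars`). Expanding (xa)·a and x·(ga) = x·(ag) removes t (`Restricts.x_of`).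
Expanding (xg)·x forces g·a = g and then g·x = 0 (`Restricts.grp_a_and_of_x`). Expanding (xg)·l
yields the compatibility of χ with the operations (`Restricts.chi_mul_chi`), and the first cycle
identity at (x, g, x) yields χ² = 1 (`chi_sq`).

Conversely, χ² = 1 and χ(a) ≠ 1 give χ(a) = -1, so n = 2 and H has the basis g, gx. The formulas
then define both operations completely, which gives uniqueness, and the axioms are multilinear
identities to be checked on basis elements. Regularity holds because the relevant maps are
triangular on a finite-dimensional space (`Formulas.bijective_gMap`).

Exchanging · and : replaces λ₁₀ by -λ₁₀ and preserves the axioms in use, so most statements are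
proved for · only and transferred by `swap`. -/

noncomputable section
namespace RankOne.Datum

universe u v
variable {k : Type u} {G : Type v} [Field k] [Group G]

/-! ### The basis `g xⁱ` -/

theorem chi_pow_mul_alpha (D : Datum k G) (h : G) (w : D.alpha ≠ 0 → D.a ^ D.n ≠ 1) :
    D.alpha = 0 ∨ (D.chi h : k) ^ D.n = 1 := by
  rcases D.compat with (h1 | h1) | h1
  · exact Or.inl h1
  · by_cases h0 : D.alpha = 0
    · exact Or.inl h0
    · exact absurd h1 (w h0)
  · right
    have := congrArg (fun f : G →* kˣ => ((f h : kˣ) : k)) h1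
    exact (by simpa using this : (D.chi h : k) ^ orderOf (D.chi D.a) = 1)

/-- The index type of the basis. -/
abbrev Idx (D : Datum k G) := G × Fin D.n

/-- Left multiplication by `g` in terms of the basis. -/
def grpOp (D : Datum k G) : G →* Module.End k (D.Idx →₀ k) where
  toFun g := Finsupp.lmapDomain k k (fun p : D.Idx => (g * p.1, p.2))
  map_one' := by ext; simp
  map_mul' g h := by ext; simp [mul_assoc]

/-- Left multiplication by `x` in terms of the basis. -/
def shiftOp (D : Datum k G) : Module.End k (D.Idx →₀ k) :=
  Finsupp.linearCombination k fun p : D.Idx => (D.chi p.1 : k) •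
    if h : (p.2 : ℕ) + 1 < D.n then Finsupp.single (p.1, ⟨p.2 + 1, h⟩) (1 : k)
    else D.alpha • (Finsupp.single (p.1 * D.a ^ D.n, ⟨0, D.n_pos⟩) 1 -
      Finsupp.single (p.1, ⟨0, D.n_pos⟩) 1)

theorem grpOp_single (D : Datum k G) (g h : G) (i : Fin D.n) :
    D.grpOp g (Finsupp.single (h, i) 1) = Finsupp.single (g * h, i) 1 := by
  simp [grpOp]

theorem shiftOp_single_lt (D : Datum k G) (h : G) (i : ℕ) (hi : i + 1 < D.n) :
    D.shiftOp (Finsupp.single (h, ⟨i, by omega⟩) 1) =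
      (D.chi h : k) • Finsupp.single (h, ⟨i + 1, hi⟩) 1 := by
  simp [shiftOp, hi]

theorem shiftOp_single_last (D : Datum k G) (h : G) (i : ℕ) (hi : i + 1 = D.n) :
    D.shiftOp (Finsupp.single (h, ⟨i, by omega⟩) 1) =
      (D.chi h : k) • D.alpha • (Finsupp.single (h * D.a ^ D.n, ⟨0, D.n_pos⟩) 1 -
      Finsupp.single (h, ⟨0, D.n_pos⟩) 1) := by
  have : ¬ (i + 1 < D.n) := by omega
  simp [shiftOp, this]

theorem shiftOp_pow_single (D : Datum k G) (h : G) (i j : ℕ) (hi : i + j < D.n) :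
    (D.shiftOp ^ j) (Finsupp.single (h, ⟨i, by omega⟩) 1) =
      (D.chi h : k) ^ j • Finsupp.single (h, ⟨i + j, hi⟩) 1 := by
  induction j with
  | zero => simp
  | succ j ih =>
    rw [pow_succ', Module.End.mul_apply, ih (by omega), map_smul,
      D.shiftOp_single_lt h (i + j) (by omega), smul_smul, pow_succ]
    rfl

theorem chi_a_pow (D : Datum k G) : D.chi D.a ^ D.n = 1 := pow_orderOf_eq_one _

theorem a_pow_comm (D : Datum k G) (g : G) (m : ℕ) : D.a ^ m * g = g * D.a ^ m :=
  (Subgroup.mem_center_iff.1 (Subgroup.pow_mem _ D.central m) g).symm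

/-- Starting from h xⁱ, the n shifts climb to exponent n - 1, wrap around once and climb back to i.
Each shift contributes χ(h), because χ(aⁿ) = 1. The total factor χ(h)ⁿ is harmless by the
compatibility condition of the datum: either aⁿ = 1 and the difference vanishes, or α = 0, or χ(h)ⁿ
= 1. -/
theorem shiftOp_pow_n_single (D : Datum k G) (h : G) (i : Fin D.n) :
    (D.shiftOp ^ D.n) (Finsupp.single (h, i) 1) =
      D.alpha • (Finsupp.single (h * D.a ^ D.n, i) 1 - Finsupp.single (h, i) 1) := by
  obtain ⟨i, hi⟩ := i
  have e : D.n = i + (1 + (D.n - 1 - i)) := by omega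
  have step : (D.shiftOp ^ D.n) (Finsupp.single (h, ⟨i, hi⟩) 1) =
      ((D.chi h : k) ^ D.n * D.alpha) •
        (Finsupp.single (h * D.a ^ D.n, ⟨i, hi⟩) 1 - Finsupp.single (h, ⟨i, hi⟩) 1) := by
    have e1 : D.shiftOp ^ D.n = D.shiftOp ^ i * (D.shiftOp * D.shiftOp ^ (D.n - 1 - i)) := by
      rw [← pow_succ', ← pow_add]; congr 1; omega
    rw [e1, Module.End.mul_apply, Module.End.mul_apply,
      D.shiftOp_pow_single h i (D.n - 1 - i) (by omega), map_smul,
      D.shiftOp_single_last h (i + (D.n - 1 - i)) (by omega)]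
    simp only [map_smul, map_sub]
    rw [D.shiftOp_pow_single _ 0 i (by omega), D.shiftOp_pow_single _ 0 i (by omega)]
    have e2 : (D.chi (h * D.a ^ D.n) : k) = D.chi h := by
      rw [map_mul, map_pow, chi_a_pow, mul_one]
    have e3 : (D.chi h : k) ^ D.n = D.chi h ^ (D.n - 1 - i) * D.chi h * D.chi h ^ i := by
      rw [← pow_succ, ← pow_add]; congr 1; omega
    rw [e2, e3, ← smul_sub]
    simp only [smul_smul, zero_add]
    congr 1
    ring
  rw [step]
  by_cases hw : D.a ^ D.n = 1
  · simp [hw]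
  · rcases D.chi_pow_mul_alpha h (fun _ => hw) with h0 | h0
    · simp [h0]
    · rw [h0, one_mul]

/-- The representation of `H_D` on the free module with basis `G × Fin n`. -/
def rep (D : Datum k G) : D.H →ₐ[k] Module.End k (D.Idx →₀ k) :=
  D.lift D.grpOp D.shiftOp
    (by
      ext ⟨h, i⟩ : 2
      simp only [LinearMap.comp_apply, Finsupp.lsingle_apply, shiftOp_pow_n_single,
        LinearMap.smul_apply, LinearMap.sub_apply, Module.End.one_apply, ← map_pow, grpOp_single,
        a_pow_comm])
    (by
      intro g
      ext ⟨h, i, hi⟩ : 2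
      simp only [LinearMap.comp_apply, Finsupp.lsingle_apply, Module.End.mul_apply,
        LinearMap.smul_apply, grpOp_single]
      rcases Nat.lt_or_ge (i + 1) D.n with h1 | h1
      · rw [D.shiftOp_single_lt _ i h1, D.shiftOp_single_lt _ i h1, map_smul, grpOp_single,
          smul_smul, map_mul, Units.val_mul]
      · rw [D.shiftOp_single_last _ i (by omega), D.shiftOp_single_last _ i (by omega)]
        simp only [map_smul, map_sub, grpOp_single, smul_smul, map_mul, Units.val_mul, mul_assoc])

theorem rep_apply (D : Datum k G) (g : G) (i : Fin D.n) :
    D.rep (D.of g * D.x ^ (i : ℕ)) (Finsupp.single (1, ⟨0, D.n_pos⟩) 1) =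
      Finsupp.single (g, i) 1 := by
  have hi : 0 + (i : ℕ) < D.n := by omega
  rw [map_mul, map_pow, Module.End.mul_apply, rep, lift_x, lift_of,
    D.shiftOp_pow_single 1 0 i hi]
  simp [grpOp_single]

/-- Under the representation `rep`, the element g xⁱ sends the basis vector at (1, 0) to the basis
vector at (g, i), so a linear relation in H would give one between basis vectors. -/
theorem linearIndependent_of_mul_x_pow (D : Datum k G) :
    LinearIndependent k (fun p : D.Idx => D.of p.1 * D.x ^ (p.2 : ℕ)) := by
  let θ : D.H →ₗ[k] (D.Idx →₀ k) :=
    (LinearMap.applyₗ (Finsupp.single (1, ⟨0, D.n_pos⟩) 1)) ∘ₗ D.rep.toLinearMap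
  refine LinearIndependent.of_comp θ ?_
  have : θ ∘ (fun p : D.Idx => D.of p.1 * D.x ^ (p.2 : ℕ)) = fun p => Finsupp.single p 1 := by
    funext p
    exact D.rep_apply p.1 p.2
  rw [this]
  exact Finsupp.linearIndependent_single_one k D.Idx

/-- The span contains 1 and is stable under left multiplication by the generators, hence is a left
ideal containing 1. -/
theorem span_of_mul_x_pow (D : Datum k G) :
    ⊤ ≤ Submodule.span k (Set.range (fun p : D.Idx => D.of p.1 * D.x ^ (p.2 : ℕ))) := by
  set S := Submodule.span k (Set.range (fun p : D.Idx => D.of p.1 * D.x ^ (p.2 : ℕ))) with hS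
  have hmem : ∀ g (i : ℕ), i < D.n → D.of g * D.x ^ i ∈ S := fun g i hi =>
    Submodule.subset_span ⟨(g, ⟨i, hi⟩), rfl⟩
  have key : ∀ y : D.H, ∀ z ∈ S, y * z ∈ S := by
    intro y
    induction y using D.induction with
    | smul c y hy => intro z hz; rw [smul_mul_assoc]; exact S.smul_mem _ (hy z hz)
    | one => intro z hz; rwa [one_mul]
    | add y y' hy hy' => intro z hz; rw [add_mul]; exact S.add_mem (hy z hz) (hy' z hz)
    | mul y y' hy hy' => intro z hz; rw [mul_assoc]; exact hy _ (hy' z hz)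
    | of g =>
      intro z hz
      refine Submodule.span_induction ?_ (by simp) ?_ ?_ hz
      · rintro _ ⟨p, rfl⟩
        rw [← mul_assoc, ← map_mul]
        exact hmem _ _ p.2.2
      · intro z z' _ _ h h'; rw [mul_add]; exact S.add_mem h h'
      · intro c z _ h; rw [mul_smul_comm]; exact S.smul_mem _ h
    | x =>
      intro z hz
      refine Submodule.span_induction ?_ (by simp) ?_ ?_ hz
      · rintro _ ⟨⟨g, i, hi⟩, rfl⟩
        dsimp only
        rw [← mul_assoc, x_mul, smul_mul_assoc, mul_assoc, ← pow_succ']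
        refine S.smul_mem _ ?_
        rcases Nat.lt_or_ge (i + 1) D.n with h1 | h1
        · exact hmem _ _ h1
        · rw [show i + 1 = D.n by omega, x_pow, mul_smul_comm, mul_sub, mul_one, ← map_pow,
            ← map_mul]
          refine S.smul_mem _ (S.sub_mem ?_ ?_)
          · simpa using hmem (g * D.a ^ D.n) 0 D.n_pos
          · simpa using hmem g 0 D.n_pos
      · intro z z' _ _ h h'; rw [mul_add]; exact S.add_mem h h'
      · intro c z _ h; rw [mul_smul_comm]; exact S.smul_mem _ h
  intro y _
  simpa using key y 1 (by simpa using hmem 1 0 D.n_pos)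

/-- The basis `g xⁱ`, `g ∈ G` and `i < n`, of `H_D`. -/
def basis (D : Datum k G) : Module.Basis D.Idx k D.H :=
  Module.Basis.mk D.linearIndependent_of_mul_x_pow D.span_of_mul_x_pow

theorem basis_apply (D : Datum k G) (p : D.Idx) : D.basis p = D.of p.1 * D.x ^ (p.2 : ℕ) :=
  Module.Basis.mk_apply _ _ _

end RankOne.Datum
end

noncomputable section
namespace RankOne.Datum

universe u v
variable {k : Type u} {G : Type v} [Field k] [Group G]

/-! ### Coordinates, group-like and skew-primitive elements -/

/-- The coefficient of `g xⁱ`. -/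
def coeff (D : Datum k G) (g : G) (i : ℕ) : D.H →ₗ[k] k :=
  -- The value 0 for exponents from n on lets the formula for the coefficients of Δ be stated with
  -- exponent i + l without a bound.
  if h : i < D.n then D.basis.coord (g, ⟨i, h⟩) else 0

theorem coeff_of_le (D : Datum k G) (g : G) (i : ℕ) (h : D.n ≤ i) : D.coeff g i = 0 := by
  simp [coeff, h]

open Classical in
theorem coeff_of_mul_x_pow (D : Datum k G) (g h : G) (i m : ℕ) (hm : m < D.n) :
    D.coeff g i (D.of h * D.x ^ m) = if g = h ∧ i = m then 1 else 0 := by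
  have e : D.of h * D.x ^ m = D.basis (h, ⟨m, hm⟩) := (D.basis_apply (h, ⟨m, hm⟩)).symm
  by_cases hi : i < D.n
  · rw [coeff, dif_pos hi, e, Module.Basis.coord_apply, Module.Basis.repr_self,
      Finsupp.single_apply]
    simp only [Prod.mk.injEq, Fin.mk.injEq, eq_comm]
  · rw [D.coeff_of_le g i (by omega), if_neg (by omega)]
    rfl

open Classical in
theorem coeff_of (D : Datum k G) (g h : G) (i : ℕ) :
    D.coeff g i (D.of h) = if g = h ∧ i = 0 then 1 else 0 := by
  simpa using D.coeff_of_mul_x_pow g h i 0 D.n_pos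

open Classical in
theorem coeff_of_mul_x (D : Datum k G) (g h : G) (i : ℕ) :
    D.coeff g i (D.of h * D.x) = if g = h ∧ i = 1 then 1 else 0 := by
  simpa using D.coeff_of_mul_x_pow g h i 1 D.one_lt_n

theorem ext_coeff (D : Datum k G) {y z : D.H} (h : ∀ g i, D.coeff g i y = D.coeff g i z) :
    y = z := by
  refine D.basis.ext_elem fun ⟨g, i, hi⟩ => ?_
  simpa [coeff, hi] using h g i

/-- The coefficient of `g xⁱ ⊗ h xˡ`. -/
def coeff₂ (D : Datum k G) (g : G) (i : ℕ) (h : G) (l : ℕ) : D.H ⊗[k] D.H →ₗ[k] k :=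
  LinearMap.mul' k k ∘ₗ TensorProduct.map (D.coeff g i) (D.coeff h l)

@[simp]
theorem coeff₂_tmul (D : Datum k G) (g : G) (i : ℕ) (h : G) (l : ℕ) (y z : D.H) :
    D.coeff₂ g i h l (y ⊗ₜ z) = D.coeff g i y * D.coeff h l z := by
  simp [coeff₂]

theorem comulHom_of_mul_x_pow (D : Datum k G) (g : G) (m : ℕ) :
    D.comulHom (D.of g * D.x ^ m) = ∑ j ∈ Finset.range (m + 1),
      qc (D.chi D.a : k) m j • ((D.of g * D.x ^ j) ⊗ₜ[k] (D.of (g * D.a ^ j) * D.x ^ (m - j))) := by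
  rw [map_mul, map_pow, comulHom_of, comulHom_x, q_add_pow (D.chi D.a : k), Finset.mul_sum]
  · refine Finset.sum_congr rfl fun j _ => ?_
    rw [mul_smul_comm, Algebra.TensorProduct.tmul_pow, Algebra.TensorProduct.tmul_pow,
      Algebra.TensorProduct.tmul_mul_tmul, Algebra.TensorProduct.tmul_mul_tmul, one_pow, mul_one,
      map_mul, map_pow, mul_assoc]
  · simp only [Algebra.TensorProduct.tmul_mul_tmul, one_mul, mul_one, x_mul,
      TensorProduct.tmul_smul]

-- The coordinate form of Δ: the summands of Δ(g xᵐ) are multiples of g xʲ ⊗ g aʲ xᵐ⁻ʲ, so a given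
-- tensor of basis elements receives a contribution from at most one basis element.
open Classical in
theorem coeff₂_comul (D : Datum k G) (g : G) (i : ℕ) (h : G) (l : ℕ)
    (y : D.H) : D.coeff₂ g i h l (D.comulHom y) =
      (if h = g * D.a ^ i then qc (D.chi D.a : k) (i + l) i else 0) * D.coeff g (i + l) y := by
  have key : D.coeff₂ g i h l ∘ₗ D.comulHom.toLinearMap =
      (if h = g * D.a ^ i then qc (D.chi D.a : k) (i + l) i else 0) • D.coeff g (i + l) := by
    refine D.basis.ext fun ⟨g', m, hm⟩ => ?_
    rw [basis_apply]
    simp only [LinearMap.comp_apply, AlgHom.toLinearMap_apply, comulHom_of_mul_x_pow, map_sum,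
      map_smul, coeff₂_tmul, LinearMap.smul_apply, smul_eq_mul]
    rw [D.coeff_of_mul_x_pow g g' (i + l) m hm]
    have e : ∀ j ∈ Finset.range (m + 1), qc (D.chi D.a : k) m j *
        (D.coeff g i (D.of g' * D.x ^ j) * D.coeff h l (D.of (g' * D.a ^ j) * D.x ^ (m - j))) =
        if i = j then (if g = g' ∧ h = g * D.a ^ i ∧ i + l = m then
          qc (D.chi D.a : k) (i + l) i else 0) else 0 := by
      intro j hj
      have hj' := Finset.mem_range.1 hj
      rw [D.coeff_of_mul_x_pow _ _ _ _ (by omega), D.coeff_of_mul_x_pow _ _ _ _ (by omega)]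
      by_cases h1 : i = j
      · subst h1
        by_cases h2 : g = g'
        · subst h2
          have h3 : l = m - i ↔ i + l = m := by omega
          by_cases h4 : h = g * D.a ^ i
          · by_cases h5 : i + l = m
            · simp [h4, h5, h3]
            · simp [h4, h5, h3]
          · simp [h4]
        · simp [h2]
      · simp [h1]
    rw [Finset.sum_congr rfl e, Finset.sum_ite_eq]
    by_cases h1 : i + l = m
    · have : i ∈ Finset.range (m + 1) := Finset.mem_range.2 (by omega)
      rw [if_pos this]
      by_cases h2 : g = g' <;> simp [h1, h2]
    · simp [h1]
  exact LinearMap.congr_fun key y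

theorem of_injective (D : Datum k G) : Function.Injective D.of := by
  intro g h e
  classical
  have := congrArg (D.coeff g 0) e
  rw [coeff_of, coeff_of] at this
  by_contra hne
  simp [hne] at this

theorem exists_of_eq_of_comul (D : Datum k G) {y : D.H} (h1 : D.comulHom y = y ⊗ₜ y)
    (h2 : D.counitHom y = 1) : ∃ g, y = D.of g := by
  classical
  -- The square of the coefficient at g xᵐ is a multiple of the coefficient at g x²ᵐ, so all
  -- positive degrees vanish by descent from n. In degree 0 the coefficients are orthogonal
  -- idempotents of k, so exactly one of them is 1.
  have hpos : ∀ r m : ℕ, D.n ≤ m + r → 0 < m → ∀ g, D.coeff g m y = 0 := by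
    intro r
    induction r with
    | zero => intro m hm _ g; rw [D.coeff_of_le g m (by omega)]; rfl
    | succ r ih =>
      intro m hm h0 g
      have e := D.coeff₂_comul g m g m y
      rw [h1, coeff₂_tmul, ih (m + m) (by omega) (by omega) g, mul_zero] at e
      exact mul_self_eq_zero.1 e
  have hz : ∀ g h, g ≠ h → D.coeff g 0 y * D.coeff h 0 y = 0 := by
    intro g h hne
    have e := D.coeff₂_comul g 0 h 0 y
    rw [h1, coeff₂_tmul, pow_zero, mul_one, if_neg (Ne.symm hne), zero_mul] at e
    exact e
  have hid : ∀ g, D.coeff g 0 y * D.coeff g 0 y = D.coeff g 0 y := by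
    intro g
    have e := D.coeff₂_comul g 0 g 0 y
    simpa [h1, qc_zero] using e
  have hex : ∃ g, D.coeff g 0 y ≠ 0 := by
    by_contra! hall
    have : y = 0 := D.ext_coeff fun g i => by
      rw [map_zero]
      rcases Nat.eq_zero_or_pos i with rfl | hi
      · exact hall g
      · exact hpos D.n i (by omega) hi g
    rw [this, map_zero] at h2
    exact zero_ne_one h2
  obtain ⟨g, hg⟩ := hex
  refine ⟨g, D.ext_coeff fun h i => ?_⟩
  rw [coeff_of]
  rcases Nat.eq_zero_or_pos i with rfl | hi
  · by_cases hgh : h = g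
    · subst hgh
      simpa using mul_left_cancel₀ hg ((hid h).trans (mul_one _).symm)
    · simpa [hgh] using (mul_eq_zero.1 (hz h g hgh)).resolve_right hg
  · rw [hpos D.n i (by omega) hi h, if_neg (by omega)]

/-- This is the q-integer [m] with (1 - q)[m] = 1 - qᵐ, and q = χ(a) is a primitive n-th root of
unity. -/
theorem qc_one_ne_zero (D : Datum k G) (m : ℕ) (h0 : 0 < m) (hm : m < D.n) :
    qc (D.chi D.a : k) m 1 ≠ 0 := by
  obtain ⟨m, rfl⟩ : ∃ j, m = j + 1 := ⟨m - 1, by omega⟩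
  intro h
  have e := qc_rec (D.chi D.a : k) m 0
  rw [zero_add, h, mul_zero, qc_zero, mul_one] at e
  exact D.isPrimitiveRoot.pow_ne_one_of_pos_of_lt (by omega) hm (sub_eq_zero.1 e.symm).symm

theorem exists_of_skewPrimitive [CharZero k] (D : Datum k G) {y : D.H} (p q : G)
    (h1 : D.comulHom y = y ⊗ₜ D.of p + D.of q ⊗ₜ y) :
    ∃ c d : k, y = c • (D.of p - D.of q) + d • (D.of q * D.x) ∧ (d = 0 ∨ p = q * D.a) := by
  classical
  have e := fun g i h l => D.coeff₂_comul g i h l y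
  simp only [h1, map_add, coeff₂_tmul, coeff_of] at e
  -- The coefficient of gx ⊗ ga xᵐ⁻¹ in Δ(y) is [m] times that of g xᵐ in y, whereas the prescribed
  -- Δ(y) has no term with both exponents positive.
  have hbig : ∀ g m, 2 ≤ m → D.coeff g m y = 0 := by
    intro g m hm
    rcases Nat.lt_or_ge m D.n with hlt | hge
    · have e1 := e g 1 (g * D.a) (m - 1)
      rw [if_neg (by omega), if_neg (by omega), if_pos (by rw [pow_one]),
        show 1 + (m - 1) = m by omega] at e1
      simp only [mul_zero, zero_mul, add_zero] at e1
      exact (mul_eq_zero.1 e1.symm).resolve_left (D.qc_one_ne_zero m (by omega) hlt)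
    · rw [D.coeff_of_le g m hge]; rfl
  have hone : ∀ g, D.coeff g 1 y ≠ 0 → g = q ∧ p = q * D.a := by
    intro g hg
    have e1 := e g 1 (g * D.a) 0
    have e2 := e g 0 g 1
    simp [qc] at e1 e2
    have h2 : g = q := by
      by_contra hne
      simp [hne] at e2
      exact hg e2.symm
    refine ⟨h2, ?_⟩
    subst h2
    by_contra hne
    simp [Ne.symm hne] at e1
    exact hg e1.symm
  have hzero : ∀ g, D.coeff g 0 y =
      (D.coeff p 0 y) * ((if g = p then 1 else 0) - (if g = q then 1 else 0)) := by
    intro g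
    have e1 := e g 0 p 0
    have e2 := e g 0 g 0
    simp only [qc_zero, pow_zero, mul_one, and_true, if_true, add_zero] at e1 e2
    by_cases hgp : g = p
    · subst hgp
      by_cases hgq : g = q
      · subst hgq
        simp at e1
        simp [e1]
      · simp [hgq]
    · have hpg : p ≠ g := fun h => hgp h.symm
      by_cases hgq : g = q
      · subst hgq
        simp [hgp, hpg] at e1 ⊢
        linear_combination e1
      · simp [hgp, hpg, hgq] at e1 ⊢
        exact e1
  refine ⟨D.coeff p 0 y, D.coeff q 1 y, D.ext_coeff fun g i => ?_, ?_⟩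
  · simp only [map_add, map_smul, map_sub, coeff_of, coeff_of_mul_x, smul_eq_mul]
    rcases (show i = 0 ∨ i = 1 ∨ 2 ≤ i by omega) with rfl | rfl | hi
    · simpa using hzero g
    · by_cases hgq : g = q
      · simp [hgq]
      · simp only [hgq, one_ne_zero, and_false, false_and, if_false, sub_self, mul_zero, add_zero]
        by_contra hne
        exact hgq (hone g hne).1
    · rw [hbig g i hi]
      simp [show i ≠ 0 by omega, show i ≠ 1 by omega]
  · by_contra! h
    exact h.2 (hone q h.1).2

theorem chi_a_ne_one (D : Datum k G) : (D.chi D.a : k) ≠ 1 := by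
  have := D.isPrimitiveRoot.pow_ne_one_of_pos_of_lt one_ne_zero D.one_lt_n
  rwa [pow_one] at this

theorem a_ne_one (D : Datum k G) : D.a ≠ 1 := by
  intro h
  apply D.chi_a_ne_one
  rw [h, map_one, Units.val_one]

/-- Most scalar equations below are read off in the plane spanned by x and 1 - a, which is
two-dimensional because a ≠ 1. -/
theorem smul_x_add_inj (D : Datum k G) {c d c' d' : k}
    (h : c • D.x + d • (1 - D.of D.a) = c' • D.x + d' • (1 - D.of D.a)) : c = c' ∧ d = d' := by
  classical
  have hx : D.x = D.of 1 * D.x := by rw [map_one, one_mul]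
  rw [hx, ← map_one D.of] at h
  have h0 := congrArg (D.coeff 1 0) h
  have h1 := congrArg (D.coeff 1 1) h
  simp only [map_add, map_smul, map_sub, coeff_of, coeff_of_mul_x, smul_eq_mul] at h0 h1
  simp [Ne.symm D.a_ne_one] at h0 h1
  exact ⟨h1, h0⟩

end RankOne.Datum
end

noncomputable section

namespace HopfQBrace

open Coalgebra TensorProduct

section Coalg

variable {k X : Type*} [Field k] [AddCommGroup X] [Module k X] [Coalgebra k X]

/-! ### The operations of a `q`-magma coalgebra are coalgebra morphisms -/

variable (k X) in
/-- The map `ε ⊗ id`. -/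
def counitLeft : X ⊗[k] X →ₗ[k] X :=
  (TensorProduct.lid k X).toLinearMap ∘ₗ counit.rTensor X

variable (k X) in
/-- The map `id ⊗ ε`. -/
def counitRight : X ⊗[k] X →ₗ[k] X :=
  (TensorProduct.rid k X).toLinearMap ∘ₗ counit.lTensor X

@[simp]
theorem counitLeft_tmul (x y : X) : counitLeft k X (x ⊗ₜ y) = counit (R := k) x • y := by
  simp [counitLeft]

@[simp]
theorem counitRight_tmul (x y : X) : counitRight k X (x ⊗ₜ y) = counit (R := k) y • x := by
  simp [counitRight]

@[simp]
theorem counitLeft_comul (x : X) : counitLeft k X (comul x) = x := by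
  simp [counitLeft]

@[simp]
theorem counitRight_comul (x : X) : counitRight k X (comul x) = x := by
  simp [counitRight]

theorem counitLeft_comm (t : X ⊗[k] X) :
    counitLeft k X (TensorProduct.comm k X X t) = counitRight k X t := by
  induction t with
  | zero => simp
  | add t t' h h' => simp only [map_add, h, h']
  | tmul x y => simp

theorem counitRight_comm (t : X ⊗[k] X) :
    counitRight k X (TensorProduct.comm k X X t) = counitLeft k X t := by
  induction t with
  | zero => simp
  | add t t' h h' => simp only [map_add, h, h']
  | tmul x y => simp

@[simp]
theorem counitTensor_tmul (x y : X) :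
    counitTensor k X (x ⊗ₜ y) = counit (R := k) x * counit (R := k) y := by
  simp [counitTensor]

theorem counitTensor_eq (t : X ⊗[k] X) :
    counitTensor k X t = counit (R := k) (counitLeft k X t) := by
  induction t with
  | zero => simp
  | add t t' h h' => simp only [map_add, h, h']
  | tmul x y => simp

theorem counitTensor_comm (t : X ⊗[k] X) :
    counitTensor k X (TensorProduct.comm k X X t) = counitTensor k X t := by
  induction t with
  | zero => simp
  | add t t' h h' => simp only [map_add, h, h']
  | tmul x y => simp [mul_comm]

theorem map_counitLeft (s t : X ⊗[k] X) :
    TensorProduct.map (counitLeft k X) (counitLeft k X)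
      (TensorProduct.tensorTensorTensorComm k X X X X (s ⊗ₜ t)) = counitTensor k X s • t := by
  induction s with
  | zero => simp
  | add s s' h h' => simp only [map_add, add_tmul, h, h', add_smul]
  | tmul x y =>
    induction t with
    | zero => simp
    | add s s' h h' => simp only [map_add, tmul_add, h, h', smul_add]
    | tmul z w => simp [smul_tmul', tmul_smul, smul_smul, mul_comm]

theorem map_counitRight (s t : X ⊗[k] X) :
    TensorProduct.map (counitRight k X) (counitRight k X)
      (TensorProduct.tensorTensorTensorComm k X X X X (s ⊗ₜ t)) = counitTensor k X t • s := by
  induction s with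
  | zero => simp
  | add s s' h h' => simp only [map_add, add_tmul, h, h', smul_add]
  | tmul x y =>
    induction t with
    | zero => simp
    | add s s' h h' => simp only [map_add, tmul_add, h, h', add_smul]
    | tmul z w => simp [smul_tmul', tmul_smul, smul_smul, mul_comm]

theorem counitLeft_map (f g : X →ₗ[k] X →ₗ[k] X)
    (hf : ∀ x y, counit (R := k) (f x y) = counit (R := k) x * counit (R := k) y)
    (s t : X ⊗[k] X) :
    counitLeft k X (TensorProduct.map (TensorProduct.lift f) (TensorProduct.lift g)
      (TensorProduct.tensorTensorTensorComm k X X X X (s ⊗ₜ t))) =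
      g (counitLeft k X s) (counitLeft k X t) := by
  induction s with
  | zero => simp
  | add s s' h h' => simp only [map_add, add_tmul, h, h', LinearMap.add_apply]
  | tmul x y =>
    induction t with
    | zero => simp
    | add s s' h h' => simp only [map_add, tmul_add, h, h']
    | tmul z w => simp [hf, smul_smul, mul_comm]

theorem counitRight_map (f g : X →ₗ[k] X →ₗ[k] X)
    (hg : ∀ x y, counit (R := k) (g x y) = counit (R := k) x * counit (R := k) y)
    (s t : X ⊗[k] X) :
    counitRight k X (TensorProduct.map (TensorProduct.lift f) (TensorProduct.lift g)
      (TensorProduct.tensorTensorTensorComm k X X X X (s ⊗ₜ t))) =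
      f (counitRight k X s) (counitRight k X t) := by
  induction s with
  | zero => simp
  | add s s' h h' => simp only [map_add, add_tmul, h, h', LinearMap.add_apply]
  | tmul x y =>
    induction t with
    | zero => simp
    | add s s' h h' => simp only [map_add, tmul_add, h, h']
    | tmul z w => simp [hg, smul_smul, mul_comm]

variable {dot col : X →ₗ[k] X →ₗ[k] X}

theorem hMap_tmul (x y : X) : hMap dot col (x ⊗ₜ y) =
    TensorProduct.map (TensorProduct.lift col.flip) (TensorProduct.lift dot)
      (TensorProduct.tensorTensorTensorComm k X X X X (comulCop k X x ⊗ₜ comul y)) := by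
  simp [hMap, comulTensor]

theorem counit_col_flip (h : IsQMagmaCoalgebra dot col) (x y : X) :
    counit (R := k) (col.flip x y) = counit (R := k) x * counit (R := k) y := by
  rw [LinearMap.flip_apply, h.counit_col, mul_comm]

/-- Since ε(y₍₁₎ : x₍₂₎) = ε(y₍₁₎)ε(x₍₂₎), the counit axioms contract the first factor. Applied to
the morphism condition on `hMap`, this isolates the condition on · alone; the mirror statement
isolates the one on :. -/
theorem counitLeft_hMap (h : IsQMagmaCoalgebra dot col) (t : X ⊗[k] X) :
    counitLeft k X (hMap dot col t) = TensorProduct.lift dot t := by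
  induction t with
  | zero => simp
  | add t t' h h' => simp only [map_add, h, h']
  | tmul x y =>
    rw [hMap_tmul, counitLeft_map _ _ (counit_col_flip h), comulCop, LinearMap.comp_apply,
      LinearEquiv.coe_coe, counitLeft_comm]
    simp

theorem counitRight_hMap (h : IsQMagmaCoalgebra dot col) (t : X ⊗[k] X) :
    counitRight k X (hMap dot col t) = TensorProduct.lift col.flip t := by
  induction t with
  | zero => simp
  | add t t' h h' => simp only [map_add, h, h']
  | tmul x y =>
    rw [hMap_tmul, counitRight_map _ _ h.counit_dot, comulCop, LinearMap.comp_apply,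
      LinearEquiv.coe_coe, counitRight_comm]
    simp

theorem counitTensor_comul (x : X) : counitTensor k X (comul x) = counit (R := k) x := by
  rw [counitTensor_eq, counitLeft_comul]

theorem map_counitLeft_comulTensor (t : X ⊗[k] X) :
    TensorProduct.map (counitLeft k X) (counitLeft k X) (comulTensor (comulCop k X) comul t) =
      comul (counitLeft k X t) := by
  induction t with
  | zero => simp
  | add t t' h h' => simp only [map_add, h, h']
  | tmul x y =>
    simp [comulTensor, comulCop, map_counitLeft, counitTensor_comm, counitTensor_comul]

theorem map_counitRight_comulTensor (t : X ⊗[k] X) :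
    TensorProduct.map (counitRight k X) (counitRight k X) (comulTensor (comulCop k X) comul t) =
      comulCop k X (counitRight k X t) := by
  induction t with
  | zero => simp
  | add t t' h h' => simp only [map_add, h, h']
  | tmul x y =>
    simp [comulTensor, comulCop, map_counitRight, counitTensor_comul]

/-- `Δ(x · y) = x₍₁₎ · y₍₂₎ ⊗ x₍₂₎ · y₍₁₎`. -/
theorem comul_dot (h : IsQMagmaCoalgebra dot col) (x y : X) :
    comul (R := k) (dot x y) = TensorProduct.map (TensorProduct.lift dot) (TensorProduct.lift dot)
      (comulTensor comul (comulCop k X) (x ⊗ₜ y)) := by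
  have e := congrArg (TensorProduct.map (counitLeft k X) (counitLeft k X))
    (LinearMap.congr_fun h.comul_hMap (x ⊗ₜ y))
  rw [LinearMap.comp_apply, LinearMap.comp_apply, map_counitLeft_comulTensor,
    counitLeft_hMap h, ← LinearMap.comp_apply (TensorProduct.map _ _), ← TensorProduct.map_comp,
    show counitLeft k X ∘ₗ hMap dot col = TensorProduct.lift dot from
      LinearMap.ext (counitLeft_hMap h)] at e
  simpa using e

/-- Contracting `hMap` on the other side gives : with its arguments reversed and values in X^cop.
The reversal and the co-opposite cancel, so : obeys the same coproduct rule as ·. -/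
theorem comm_map_flip {Y : Type*} [AddCommGroup Y] [Module k Y]
    (f : Y →ₗ[k] Y →ₗ[k] Y) (s t : Y ⊗[k] Y) :
    TensorProduct.comm k Y Y (TensorProduct.map (TensorProduct.lift f.flip)
      (TensorProduct.lift f.flip) (TensorProduct.tensorTensorTensorComm k Y Y Y Y
        (t ⊗ₜ TensorProduct.comm k Y Y s))) =
    TensorProduct.map (TensorProduct.lift f) (TensorProduct.lift f)
      (TensorProduct.tensorTensorTensorComm k Y Y Y Y (s ⊗ₜ TensorProduct.comm k Y Y t)) := by
  induction s with
  | zero => simp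
  | add s s' h h' => simp only [map_add, add_tmul, tmul_add, h, h']
  | tmul x y =>
    induction t with
    | zero => simp
    | add s s' h h' => simp only [map_add, add_tmul, tmul_add, h, h']
    | tmul z w => simp

/-- `Δ(x : y) = x₍₁₎ : y₍₂₎ ⊗ x₍₂₎ : y₍₁₎`. -/
theorem comul_col (h : IsQMagmaCoalgebra dot col) (x y : X) :
    comul (R := k) (col x y) = TensorProduct.map (TensorProduct.lift col) (TensorProduct.lift col)
      (comulTensor comul (comulCop k X) (x ⊗ₜ y)) := by
  have e := congrArg (TensorProduct.map (counitRight k X) (counitRight k X))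
    (LinearMap.congr_fun h.comul_hMap (y ⊗ₜ x))
  rw [LinearMap.comp_apply, LinearMap.comp_apply, map_counitRight_comulTensor,
    counitRight_hMap h, ← LinearMap.comp_apply (TensorProduct.map _ _), ← TensorProduct.map_comp,
    show counitRight k X ∘ₗ hMap dot col = TensorProduct.lift col.flip from
      LinearMap.ext (counitRight_hMap h)] at e
  have e' := congrArg (TensorProduct.comm k X X) e
  simp only [comulTensor, comulCop, LinearMap.comp_apply, LinearEquiv.coe_coe,
    TensorProduct.map_tmul, comm_map_flip, TensorProduct.lift.tmul, LinearMap.flip_apply] at e' ⊢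
  rw [← e']
  exact ((TensorProduct.comm k X X).symm_apply_apply _).symm

end Coalg

/-- The part of the axioms of a Hopf `q`-brace that is visibly symmetric in both operations. -/
structure IsPreBrace {k H : Type*} [Field k] [Ring H] [HopfAlgebra k H]
    (dot col : H →ₗ[k] H →ₗ[k] H) : Prop where
  counit_dot : ∀ x y, counit (R := k) (dot x y) = counit (R := k) x * counit (R := k) y
  counit_col : ∀ x y, counit (R := k) (col x y) = counit (R := k) x * counit (R := k) y
  comul_dot : ∀ x y, comul (R := k) (dot x y) =
    TensorProduct.map (TensorProduct.lift dot) (TensorProduct.lift dot)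
      (comulTensor comul (comulCop k H) (x ⊗ₜ y))
  comul_col : ∀ x y, comul (R := k) (col x y) =
    TensorProduct.map (TensorProduct.lift col) (TensorProduct.lift col)
      (comulTensor comul (comulCop k H) (x ⊗ₜ y))
  dot_one : ∀ h, dot h 1 = h
  dot_mul : ∀ h l m, dot h (l * m) = dot (dot h m) l
  col_one : ∀ h, col h 1 = h
  col_mul : ∀ h l m, col h (l * m) = col (col h m) l
  mul_dot : ∀ h m l, dot (h * m) l =
    TensorProduct.lift ((LinearMap.mul k H).compl₁₂ (dot h) LinearMap.id)
      (hMap dot col (m ⊗ₜ l))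
  mul_col : ∀ h m l, col (h * m) l =
    TensorProduct.lift ((LinearMap.mul k H).compl₁₂ (col h) LinearMap.id)
      (hMap col dot (m ⊗ₜ l))

section

variable {k H : Type*} [Field k] [Ring H] [HopfAlgebra k H] {dot col : H →ₗ[k] H →ₗ[k] H}

theorem IsPreBrace.swap (h : IsPreBrace dot col) : IsPreBrace col dot :=
  ⟨h.counit_col, h.counit_dot, h.comul_col, h.comul_dot, h.col_one, h.col_mul, h.dot_one,
    h.dot_mul, h.mul_col, h.mul_dot⟩

theorem IsHopfQBrace.isPreBrace (h : IsHopfQBrace dot col) : IsPreBrace dot col :=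
  ⟨h.counit_dot, h.counit_col, HopfQBrace.comul_dot h.toIsQMagmaCoalgebra,
    HopfQBrace.comul_col h.toIsQMagmaCoalgebra, h.dot_one, h.dot_mul, h.col_one,
    h.col_mul, h.mul_dot, h.mul_col⟩

end

end HopfQBrace
end

/-! ### The operations on group-like elements and on x, up to scalars. -/

noncomputable section

namespace RankOne.Datum

open HopfQBrace TensorProduct

universe u v
variable {k : Type u} {G : Type v} [Field k] [Group G]

theorem comul_of (D : Datum k G) (g : G) :
    Coalgebra.comul (R := k) (D.of g) = D.of g ⊗ₜ D.of g := D.comulHom_of g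

theorem comul_x (D : Datum k G) :
    Coalgebra.comul (R := k) D.x = D.x ⊗ₜ D.of D.a + D.of 1 ⊗ₜ D.x := by
  rw [map_one]; exact D.comulHom_x

theorem comul_of_mul_x (D : Datum k G) (g : G) :
    Coalgebra.comul (R := k) (D.of g * D.x) =
      (D.of g * D.x) ⊗ₜ D.of (g * D.a) + D.of g ⊗ₜ (D.of g * D.x) := by
  rw [D.comul_eq, map_mul, comulHom_of, comulHom_x, mul_add, Algebra.TensorProduct.tmul_mul_tmul,
    Algebra.TensorProduct.tmul_mul_tmul, map_mul, mul_one]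

theorem counit_of (D : Datum k G) (g : G) : Coalgebra.counit (R := k) (D.of g) = 1 :=
  D.counitHom_of g

theorem mul_a (D : Datum k G) (g : G) : g * D.a = D.a * g := Subgroup.mem_center_iff.1 D.central g

section PreBrace

variable {D : Datum k G} {dot col : D.H →ₗ[k] D.H →ₗ[k] D.H}

/-- A coalgebra morphism sends the group-like element g ⊗ l to a group-like element, and these all
lie in G. -/
theorem exists_of_dot (h : IsPreBrace dot col) (g l : G) :
    ∃ z, dot (D.of g) (D.of l) = D.of z := by
  refine D.exists_of_eq_of_comul ?_ ?_
  · have := h.comul_dot (D.of g) (D.of l)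
    rw [D.comul_eq] at this
    simpa [comulTensor, comulCop, comul_of] using this
  · have := h.counit_dot (D.of g) (D.of l)
    rwa [counit_of, counit_of, mul_one] at this

/-- A Hopf `q`-brace structure, except for the cycle conditions, together with the
operations induced on the group-like elements. -/
structure Restricts (D : Datum k G) (dot col : D.H →ₗ[k] D.H →ₗ[k] D.H) (d c : G → G → G) : Prop
    extends IsPreBrace dot col where
  dot_of : ∀ h g, dot (D.of h) (D.of g) = D.of (d h g)
  col_of : ∀ h g, col (D.of h) (D.of g) = D.of (c h g)

theorem exists_restricts (h : IsPreBrace dot col) : ∃ d c, Restricts D dot col d c := by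
  choose d hd using exists_of_dot h
  choose c hc using exists_of_dot h.swap
  exact ⟨d, c, h, hd, hc⟩

namespace Restricts

variable {d c : G → G → G} (h : Restricts D dot col d c)
include h

theorem swap : Restricts D col dot c d := ⟨h.toIsPreBrace.swap, h.col_of, h.dot_of⟩

theorem grp_one (g : G) : d g 1 = g := by
  apply D.of_injective
  rw [← h.dot_of, map_one, h.dot_one]

theorem grp_mul (g l m : G) : d g (l * m) = d (d g m) l := by
  apply D.of_injective
  rw [← h.dot_of, map_mul, h.dot_mul, h.dot_of, h.dot_of]

theorem grp_mul_dot (g m l : G) : d (g * m) l = d g (c l m) * d m l := by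
  apply D.of_injective
  have := h.mul_dot (D.of g) (D.of m) (D.of l)
  rw [← map_mul D.of] at this
  simp only [hMap, comulTensor, comulCop, comul_of, LinearMap.comp_apply, map_tmul,
    LinearEquiv.coe_coe, tensorTensorTensorComm_tmul, lift.tmul, comm_tmul,
    LinearMap.compl₁₂_apply, LinearMap.flip_apply, h.dot_of, h.col_of, LinearMap.mul_apply',
    LinearMap.id_apply] at this
  rw [this, map_mul]

theorem grp_bijective (l : G) : Function.Bijective fun g => d g l := by
  refine Function.bijective_iff_has_inverse.2 ⟨fun g => d g l⁻¹, fun g => ?_, fun g => ?_⟩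
  · simp only [← h.grp_mul, inv_mul_cancel, h.grp_one]
  · simp only [← h.grp_mul, mul_inv_cancel, h.grp_one]

theorem one_grp (g : G) : d 1 g = 1 := by
  have := h.grp_mul_dot 1 1 g
  rw [mul_one, h.swap.grp_one] at this
  exact left_eq_mul.1 this

theorem comul_of_x (g : G) : D.comulHom (dot (D.of g) D.x) =
    dot (D.of g) D.x ⊗ₜ D.of g + D.of (d g D.a) ⊗ₜ dot (D.of g) D.x := by
  have := h.comul_dot (D.of g) D.x
  rw [D.comul_eq] at this
  simp only [comulTensor, comulCop, comul_of, comul_x, LinearMap.comp_apply, map_tmul,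
    LinearEquiv.coe_coe, tmul_add, map_add, tensorTensorTensorComm_tmul, lift.tmul, comm_tmul,
    h.dot_of, h.grp_one] at this
  rw [this, add_comm]

theorem comul_x_of (g : G) : D.comulHom (dot D.x (D.of g)) =
    dot D.x (D.of g) ⊗ₜ D.of (d D.a g) + D.of 1 ⊗ₜ dot D.x (D.of g) := by
  have := h.comul_dot D.x (D.of g)
  rw [D.comul_eq] at this
  simpa [comulTensor, comulCop, comul_of, comul_x, h.dot_of, TensorProduct.add_tmul, h.one_grp,
    ← map_one D.of, -map_one] using this

/-- The product rule for 1 = 1 * 1, together with Δ(x), gives y = y + y for y = 1·x. -/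
theorem one_x : dot (D.of 1) D.x = 0 := by
  have := h.mul_dot (D.of 1) (D.of 1) D.x
  rw [← map_mul D.of, mul_one] at this
  simp only [hMap, comulTensor, comulCop, comul_of, comul_x, LinearMap.comp_apply, map_tmul,
    LinearEquiv.coe_coe, tmul_add, map_add, tensorTensorTensorComm_tmul, lift.tmul, comm_tmul,
    LinearMap.compl₁₂_apply, LinearMap.flip_apply, h.dot_of, h.col_of, LinearMap.mul_apply',
    LinearMap.id_apply, h.one_grp, h.swap.grp_one] at this
  rw [map_one, h.col_one, mul_one, one_mul, left_eq_add] at this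
  rwa [map_one]

/-- This and the next three lemmas expand the product rule for gx and xg. Comparing the expansions
through xg = χ(g)gx produces the constraints used later. -/
theorem of_mul_x_of (g l : G) : dot (D.of g * D.x) (D.of l) =
    D.of (d g (c l D.a)) * dot D.x (D.of l) + dot (D.of g) (col (D.of l) D.x) := by
  rw [h.mul_dot]
  simp only [hMap, comulTensor, comulCop, comul_of, comul_x, LinearMap.comp_apply, map_tmul,
    LinearEquiv.coe_coe, add_tmul, map_add, tensorTensorTensorComm_tmul, lift.tmul,
    comm_tmul, LinearMap.compl₁₂_apply, LinearMap.flip_apply, h.dot_of, h.col_of,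
    LinearMap.mul_apply', LinearMap.id_apply, h.one_grp]
  rw [map_one, mul_one, add_comm]

theorem x_mul_of_of (g l : G) : dot (D.x * D.of g) (D.of l) =
    dot D.x (D.of (c l g)) * D.of (d g l) := by
  rw [h.mul_dot]
  simp only [hMap, comulTensor, comulCop, comul_of, LinearMap.comp_apply, map_tmul,
    LinearEquiv.coe_coe, tensorTensorTensorComm_tmul, lift.tmul,
    comm_tmul, LinearMap.compl₁₂_apply, LinearMap.flip_apply, h.dot_of, h.col_of,
    LinearMap.mul_apply', LinearMap.id_apply]

theorem of_mul_x_x (g : G) : dot (D.of g * D.x) D.x =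
    dot (D.of g) (col D.x (D.of D.a)) * dot D.x (D.of D.a) + dot (D.of g) (col D.x D.x) +
      D.of g * dot D.x D.x := by
  rw [h.mul_dot]
  simp only [hMap, comulTensor, comulCop, comul_x, LinearMap.comp_apply, map_tmul,
    LinearEquiv.coe_coe, tmul_add, add_tmul, map_add, tensorTensorTensorComm_tmul, lift.tmul,
    comm_tmul, LinearMap.compl₁₂_apply, LinearMap.flip_apply, h.dot_of, h.col_of,
    LinearMap.mul_apply', LinearMap.id_apply, h.one_grp, h.swap.one_grp, h.one_x, h.swap.one_x,
    h.grp_one]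
  rw [map_one, mul_one, mul_zero, add_zero]

theorem x_mul_of_x (g : G) : dot (D.x * D.of g) D.x =
    dot D.x (col D.x (D.of g)) * D.of (d g D.a) + D.x * dot (D.of g) D.x := by
  rw [h.mul_dot]
  simp only [hMap, comulTensor, comulCop, comul_x, comul_of, LinearMap.comp_apply, map_tmul,
    LinearEquiv.coe_coe, tmul_add, map_add, tensorTensorTensorComm_tmul, lift.tmul,
    comm_tmul, LinearMap.compl₁₂_apply, LinearMap.flip_apply, h.dot_of, h.col_of,
    LinearMap.mul_apply', LinearMap.id_apply, h.swap.one_grp]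
  rw [map_one, h.dot_one]

/-- If x·g had no component along x, it would be a combination of elements of G, and so would x =
(x·g)·g⁻¹, which is absurd. A nonzero component along x is possible only when a·g = a. -/
theorem a_grp [CharZero k] (g : G) : d D.a g = D.a := by
  obtain ⟨e, f, hy, hf⟩ := D.exists_of_skewPrimitive _ _ (h.comul_x_of g)
  rcases hf with rfl | hf
  · exfalso
    have e1 : dot (dot D.x (D.of g)) (D.of g⁻¹) = D.x := by
      rw [← h.dot_mul, ← map_mul, inv_mul_cancel, map_one, h.dot_one]
    rw [hy, zero_smul, add_zero, map_smul, map_sub, LinearMap.smul_apply, LinearMap.sub_apply,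
      h.dot_of, h.dot_of] at e1
    classical
    have e2 := congrArg (D.coeff 1 1) e1
    rw [← one_mul D.x, ← map_one D.of, coeff_of_mul_x] at e2
    simp [coeff_of] at e2
  · simpa using hf

/-- Since a·a = a, the element a·x is skew-primitive with both group-likes equal to a. The
difference term vanishes, and a term in ax would need a = a * a. -/
theorem a_x [CharZero k] : dot (D.of D.a) D.x = 0 := by
  obtain ⟨e, f, hy, hf⟩ := D.exists_of_skewPrimitive _ _ (h.comul_of_x D.a)
  rw [h.a_grp] at hy hf
  rw [sub_self, smul_zero, zero_add] at hy
  rcases hf with rfl | hf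
  · rw [hy, zero_smul]
  · exact absurd (left_eq_mul.1 hf) D.a_ne_one

theorem one_sub_a_of [CharZero k] (g : G) : dot (1 - D.of D.a) (D.of g) = 1 - D.of D.a := by
  rw [map_sub, LinearMap.sub_apply, h.dot_of, h.a_grp, ← map_one D.of, h.dot_of, h.one_grp]

theorem one_sub_a_x [CharZero k] : dot (1 - D.of D.a) D.x = 0 := by
  rw [map_sub, LinearMap.sub_apply, h.a_x, ← map_one D.of, h.one_x, sub_zero]

theorem exists_x_of [CharZero k] (g : G) :
    ∃ q t : k, dot D.x (D.of g) = q • D.x + t • (1 - D.of D.a) := by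
  obtain ⟨e, f, hy, -⟩ := D.exists_of_skewPrimitive _ _ (h.comul_x_of g)
  refine ⟨f, -e, ?_⟩
  rw [hy, h.a_grp, map_one, one_mul, neg_smul, ← smul_neg, neg_sub, add_comm]

theorem exists_x_x [CharZero k] (h0 : dot D.x D.x ≠ 0) : ∃ r : k, r ≠ 0 ∧
    dot D.x D.x = r • (1 - D.of D.a) ∧
    ∀ g, ∃ t : k, dot D.x (D.of g) = (D.chi g : k) • D.x + t • (1 - D.of D.a) := by
  have hc : D.comulHom (dot D.x D.x) = dot D.x D.x ⊗ₜ D.of D.a + D.of 1 ⊗ₜ dot D.x D.x := by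
    have := h.comul_dot D.x D.x
    rw [D.comul_eq] at this
    simp only [comulTensor, comulCop, comul_x, LinearMap.comp_apply, map_tmul,
      LinearEquiv.coe_coe, tmul_add, add_tmul, map_add, tensorTensorTensorComm_tmul, lift.tmul,
      comm_tmul, h.dot_of, h.one_x, h.a_x, h.one_grp, h.grp_one, tmul_zero, zero_tmul,
      add_zero, zero_add] at this
    rw [this, add_comm]
  obtain ⟨e, m, hy, -⟩ := D.exists_of_skewPrimitive _ _ hc
  rw [map_one, one_mul, ← neg_sub, smul_neg, ← neg_smul, add_comm] at hy
  -- Both equations come from (x·g)·x = χ(g)((x·x)·g), the action on x of xg = χ(g)gx, using that 1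
  -- - a is fixed by G and killed by x.
  have key : ∀ g, ∀ q t : k, dot D.x (D.of g) = q • D.x + t • (1 - D.of D.a) →
      q * m = D.chi g * (m * q) ∧ q * (-e) = D.chi g * (m * t + -e) := by
    intro g q t hq
    have e1 : dot (dot D.x (D.of g)) D.x = (D.chi g : k) • dot (dot D.x D.x) (D.of g) := by
      rw [← h.dot_mul, ← h.dot_mul, x_mul, map_smul]
    rw [hq, hy] at e1
    simp only [map_add, map_smul, LinearMap.add_apply, LinearMap.smul_apply, hq, hy,
      h.one_sub_a_of, h.one_sub_a_x, smul_zero, add_zero] at e1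
    refine D.smul_x_add_inj ?_
    calc (q * m) • D.x + (q * -e) • (1 - D.of D.a) = q • (m • D.x + -e • (1 - D.of D.a)) := by
          module
      _ = _ := e1
      _ = _ := by module
  have hq0 : ∀ g, ∀ q t : k, dot D.x (D.of g) = q • D.x + t • (1 - D.of D.a) → q ≠ 0 := by
    rintro g q t hq rfl
    have e1 : dot (dot D.x (D.of g)) (D.of g⁻¹) = D.x := by
      rw [← h.dot_mul, ← map_mul, inv_mul_cancel, map_one, h.dot_one]
    rw [hq, zero_smul, zero_add, map_smul, LinearMap.smul_apply, h.one_sub_a_of] at e1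
    have e2 : (0 : k) • D.x + t • (1 - D.of D.a) = (1 : k) • D.x + (0 : k) • (1 - D.of D.a) := by
      rw [e1]; module
    exact zero_ne_one (D.smul_x_add_inj e2).1
  -- At g = a the first equation reads qm = χ(a)qm, with q ≠ 0 and χ(a) ≠ 1.
  have hm : m = 0 := by
    obtain ⟨q, t, hq⟩ := h.exists_x_of D.a
    have e1 := (key _ _ _ hq).1
    by_contra hm
    apply D.chi_a_ne_one
    have : q * m ≠ 0 := mul_ne_zero (hq0 _ _ _ hq) hm
    apply mul_right_cancel₀ this
    linear_combination -e1
  subst hm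
  rw [zero_smul, zero_add] at hy
  have he : -e ≠ 0 := by
    intro he
    rw [he, zero_smul] at hy
    exact h0 hy
  refine ⟨-e, he, hy, fun g => ?_⟩
  obtain ⟨q, t, hq⟩ := h.exists_x_of g
  refine ⟨t, ?_⟩
  have e1 := (key _ _ _ hq).2
  have : q = D.chi g := by
    apply mul_right_cancel₀ he
    linear_combination e1
  rw [hq, this]

end Restricts
end PreBrace
end RankOne.Datum
end

/-! ### Determination of the scalars and of the full structure. -/

noncomputable section

namespace RankOne.Datum

open HopfQBrace TensorProduct

universe u v
variable {k : Type u} {G : Type v} [Field k] [Group G]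

theorem n_eq_two_of_chi_a (D : Datum k G) (hq : (D.chi D.a : k) = -1) : D.n = 2 := by
  have h1 : D.chi D.a ^ 2 = 1 := by
    ext
    rw [Units.val_pow_eq_pow_val, hq]
    simp
  have h2 : D.n ∣ 2 := orderOf_dvd_of_pow_eq_one h1
  have h3 : 1 < D.n := D.one_lt_n
  exact le_antisymm (Nat.le_of_dvd two_pos h2) h3

theorem x_mul_x (D : Datum k G) (hn : D.n = 2) :
    D.x * D.x = D.alpha • (D.of D.a * D.of D.a - 1) := by
  have := D.x_pow
  rwa [hn, sq, sq] at this

variable {D : Datum k G} {dot col : D.H →ₗ[k] D.H →ₗ[k] D.H} {d c : G → G → G}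

theorem chi_a_and_scalars [CharZero k] (h : Restricts D dot col d c) (hb : IsHopfQBrace dot col)
    (h1 : dot D.x D.x ≠ 0) (h2 : col D.x D.x ≠ 0) : (D.chi D.a : k) = -1 ∧ ∃ r : k, r ≠ 0 ∧
      dot D.x D.x = r • (1 - D.of D.a) ∧ col D.x D.x = -r • (1 - D.of D.a) := by
  obtain ⟨r, hr, hxx, hx⟩ := h.exists_x_x h1
  obtain ⟨r', hr', hxx', hx'⟩ := h.swap.exists_x_x h2
  obtain ⟨t, ht⟩ := hx D.a
  obtain ⟨s, hs⟩ := hx' D.a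
  have c1 := hb.cycle₁ D.x D.x D.x
  have c2 := hb.cycle₂ D.x D.x D.x
  have o1 : ∀ y, dot y (D.of 1) = y := fun y => by rw [map_one, hb.dot_one]
  have o2 : ∀ y, col y (D.of 1) = y := fun y => by rw [map_one, hb.col_one]
  have s1 : ∀ y, dot y (1 - D.of D.a) = y - dot y (D.of D.a) := fun y => by
    rw [map_sub, hb.dot_one]
  have s2 : ∀ y, col y (1 - D.of D.a) = y - col y (D.of D.a) := fun y => by
    rw [map_sub, hb.col_one]
  simp only [comulCop, comul_x, LinearMap.comp_apply, LinearEquiv.coe_coe, map_add, lift.tmul,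
    comm_tmul, LinearMap.compl₁₂_apply, o1, o2, hxx, hxx', ht, hs, map_smul, LinearMap.add_apply,
    LinearMap.smul_apply, h.one_sub_a_of, h.one_sub_a_x, h.swap.one_sub_a_of, h.swap.one_sub_a_x,
    s1, s2, smul_zero, zero_add, add_zero, sub_self] at c1 c2
  set q : k := ((D.chi D.a : kˣ) : k) with hq
  have e1 : r' * (1 - q) = r * (q - q * q) := by
    -- Only the x-components are needed; the coefficients of 1 - a are those obtained by expanding
    -- both sides of the cycle identity.
    refine (D.smul_x_add_inj (d := - (r' * t)) (d' := r * (t - q * t - t)) ?_).1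
    calc _ = r' • (D.x - (q • D.x + t • (1 - D.of D.a))) := by module
      _ = _ := c1
      _ = _ := by module
  have e2 : r * (1 - q) = r' * (q - q * q) := by
    refine (D.smul_x_add_inj (d := - (r * s)) (d' := -(r' * q * t)) ?_).1
    calc _ = r • (D.x - (q • D.x + s • (1 - D.of D.a))) := by module
      _ = _ := c2
      _ = _ := by module
  have hq1 : 1 - q ≠ 0 := sub_ne_zero.2 (Ne.symm D.chi_a_ne_one)
  have e3 : r' = r * q := mul_right_cancel₀ hq1 (by linear_combination e1)
  have e4 : r = r' * q := mul_right_cancel₀ hq1 (by linear_combination e2)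
  have e5 : q = -1 := by
    refine (eq_or_eq_neg_of_sq_eq_sq q 1 (mul_left_cancel₀ hr ?_)).resolve_left D.chi_a_ne_one
    linear_combination -e4 - q * e3
  refine ⟨e5, r, hr, hxx, ?_⟩
  rw [hxx', e3, e5, mul_neg_one]

namespace Restricts

variable (h : Restricts D dot col d c)
include h

theorem x_of [CharZero k] (hq : (D.chi D.a : k) = -1)
    (hx : ∀ g, ∃ t : k, dot D.x (D.of g) = (D.chi g : k) • D.x + t • (1 - D.of D.a)) (g : G) :
    dot D.x (D.of g) = (D.chi g : k) • D.x := by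
  have h2 : (2 : k) ≠ 0 := two_ne_zero
  -- The two expansions of (xa)·a = -(ax)·a give (x·a)a = -a(x·a). For x·a = -x + t(1 - a) the terms
  -- in ax agree, and the coefficient of a leaves 2t = 0.
  have ha : dot D.x (D.of D.a) = -D.x := by
    obtain ⟨t, ht⟩ := hx D.a
    have e1 := h.x_mul_of_of D.a D.a
    rw [x_mul, map_smul, LinearMap.smul_apply, h.of_mul_x_of, h.swap.a_x, map_zero, add_zero,
      h.swap.a_grp, h.a_grp, ht, hq] at e1
    simp only [mul_add, add_mul, mul_sub, sub_mul, smul_mul_assoc, mul_smul_comm, x_mul, hq,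
      mul_one, one_mul, ← map_mul] at e1
    classical
    have e2 := congrArg (D.coeff D.a 0) e1
    simp only [map_add, map_sub, map_smul, coeff_of, coeff_of_mul_x, smul_eq_mul,
      left_eq_mul, D.a_ne_one] at e2
    have ht0 : t = 0 := by
      simp at e2
      refine (mul_eq_zero.1 (?_ : 2 * t = 0)).resolve_left h2
      linear_combination -e2
    rw [ht, ht0, hq]
    module
  obtain ⟨t, ht⟩ := hx g
  -- Acting by a negates x but fixes 1 - a, so performing it before or after g changes the sign of
  -- t.
  have e1 : dot D.x (D.of (g * D.a)) = dot D.x (D.of (D.a * g)) := by rw [mul_a]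
  rw [map_mul D.of, map_mul D.of, h.dot_mul, h.dot_mul, ha, map_neg, LinearMap.neg_apply, ht,
    map_add, LinearMap.add_apply, map_smul, LinearMap.smul_apply, map_smul, LinearMap.smul_apply, ha,
    h.one_sub_a_of] at e1
  have e2 : (-(D.chi g : k)) • D.x + (-t) • (1 - D.of D.a) =
      (-(D.chi g : k)) • D.x + t • (1 - D.of D.a) := by
    calc _ = _ := by module
      _ = _ := e1
      _ = _ := by module
  have ht0 : t = 0 := by
    refine (mul_eq_zero.1 (?_ : 2 * t = 0)).resolve_left h2
    linear_combination -(D.smul_x_add_inj e2).2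
  rw [ht, ht0, zero_smul, add_zero]

/-- With w = g·a and y = g·x, the two expansions of (xg)·x = χ(g)(gx)·x give χ(g)(yx + r(w - ga)) =
χ(g)r(w - aw) + xy, where y is a combination of g - w and wx. This forces w = g; then y = 0, because
a component along gx would need g = ga. -/
theorem grp_a_and_of_x [CharZero k] (hq : (D.chi D.a : k) = -1) {r : k} (hr : r ≠ 0)
    (hxx : dot D.x D.x = r • (1 - D.of D.a)) (hxx' : col D.x D.x = -r • (1 - D.of D.a))
    (hx : ∀ g, dot D.x (D.of g) = (D.chi g : k) • D.x)
    (hx' : ∀ g, col D.x (D.of g) = (D.chi g : k) • D.x) (g : G) :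
    d g D.a = g ∧ dot (D.of g) D.x = 0 := by
  have hn := D.n_eq_two_of_chi_a hq
  obtain ⟨e, f, hy, hf⟩ := D.exists_of_skewPrimitive _ _ (h.comul_of_x g)
  have e1 := h.x_mul_of_x g
  rw [x_mul, map_smul, LinearMap.smul_apply, h.of_mul_x_x, hx', hx', hx, hxx, hxx', hq,
    map_smul, map_smul, map_smul, hxx, map_sub, h.dot_one, h.dot_of, hy] at e1
  set w := d g D.a with hw
  have hg0 : (D.chi g : k) ≠ 0 := (D.chi g).ne_zero
  have hxx2 : ∀ z, D.of z * D.x * D.x = D.alpha • (D.of (z * D.a * D.a) - D.of z) := by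
    intro z
    rw [mul_assoc, x_mul_x D hn, mul_smul_comm, mul_sub, mul_one, map_mul, map_mul, mul_assoc]
  simp only [smul_mul_assoc, mul_smul_comm, mul_add, add_mul, mul_sub, sub_mul, one_mul, mul_one,
    x_mul, ← mul_assoc, hxx2, ← map_mul D.of] at e1
  have hga : g ≠ g * D.a := by simpa using D.a_ne_one
  have hwg : w = g := by
    by_contra hne
    classical
    refine mul_ne_zero hg0 hr ?_
    rcases hf with rfl | hf
    -- Without a term in wx, the products yx and xy have no part in degree 0, so ga must cancel
    -- against aw.
    · have e2 := congrArg (D.coeff (g * D.a) 0) e1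
      have n1 : g * D.a ≠ D.a * w := by rw [mul_a]; simpa using Ne.symm hne
      simp only [map_add, map_sub, map_smul, coeff_of, coeff_of_mul_x, smul_eq_mul, n1,
        Ne.symm hga, zero_ne_one, and_false, and_true, if_false, if_true] at e2
      linear_combination -e2
    -- Here g = wa, and w x² lies in the span of ga and w. So g occurs in degree 0 only through aw.
    · have e2 := congrArg (D.coeff g 0) e1
      have n1 : w * D.a * D.a = g * D.a := by rw [← hf]
      have n2 : D.a * w = g := by rw [← mul_a, hf]
      simp only [map_add, map_sub, map_smul, coeff_of, coeff_of_mul_x, smul_eq_mul, n1, n2,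
        hga, Ne.symm hne, zero_ne_one, and_false, and_true, if_false, if_true] at e2
      linear_combination e2
  refine ⟨hwg, ?_⟩
  rcases hf with rfl | hf
  · rw [hy, hwg, sub_self, smul_zero, zero_smul, zero_add]
  · rw [hwg] at hf
    exact absurd (left_eq_mul.1 hf) D.a_ne_one

theorem of_mul_x_of_eq [CharZero k] (hx : ∀ g, dot D.x (D.of g) = (D.chi g : k) • D.x)
    (ha : ∀ g, c g D.a = g ∧ col (D.of g) D.x = 0) (g l : G) :
    dot (D.of g * D.x) (D.of l) = (D.chi l : k) • (D.of (d g l) * D.x) := by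
  rw [h.of_mul_x_of, (ha l).1, (ha l).2, map_zero, add_zero, hx, mul_smul_comm]

theorem of_of_mul_x (ha : ∀ g, d g D.a = g ∧ dot (D.of g) D.x = 0) (g l : G) :
    dot (D.of g) (D.of l * D.x) = 0 := by
  rw [h.dot_mul, (ha g).2, map_zero, LinearMap.zero_apply]

theorem of_mul_x_of_mul_x [CharZero k] {r : k}
    (hxx : dot D.x D.x = r • (1 - D.of D.a)) (hxx' : col D.x D.x = -r • (1 - D.of D.a))
    (hx' : ∀ g, col D.x (D.of g) = (D.chi g : k) • D.x)
    (ha : ∀ g, d g D.a = g ∧ dot (D.of g) D.x = 0)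
    (ha' : ∀ g, c g D.a = g ∧ col (D.of g) D.x = 0) (g l : G) :
    dot (D.of g * D.x) (D.of l * D.x) = r • (D.of (d g l) * (1 - D.of D.a)) := by
  have e : d (g * D.a) l = d g l * D.a := by
    rw [h.grp_mul_dot, (ha' l).1, h.a_grp]
  rw [h.dot_mul, h.of_mul_x_x, hx', hxx', hxx, map_smul, (ha g).2, smul_zero, zero_mul, zero_add,
    map_smul, map_sub, h.dot_one, h.dot_of, (ha g).1, sub_self, smul_zero, zero_add,
    mul_smul_comm, mul_sub, mul_one, ← map_mul, map_smul, LinearMap.smul_apply, map_sub,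
    LinearMap.sub_apply, h.dot_of, h.dot_of, e, mul_sub, mul_one, map_mul]

theorem chi_mul_chi [CharZero k] (hx : ∀ g, dot D.x (D.of g) = (D.chi g : k) • D.x)
    (ha' : ∀ g, c g D.a = g ∧ col (D.of g) D.x = 0) (g l : G) :
    D.chi g * D.chi l = D.chi (c l g) * D.chi (d g l) := by
  have e1 := h.x_mul_of_of g l
  rw [x_mul, map_smul, LinearMap.smul_apply, h.of_mul_x_of_eq hx ha', hx, smul_mul_assoc, x_mul,
    smul_smul, smul_smul] at e1
  classical
  have e2 := congrArg (D.coeff (d g l) 1) e1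
  rw [map_smul, map_smul, coeff_of_mul_x] at e2
  ext
  simpa using e2

end Restricts

theorem chi_sq [CharZero k] (h : Restricts D dot col d c) (hb : IsHopfQBrace dot col) {r : k}
    (hr : r ≠ 0) (hxx : dot D.x D.x = r • (1 - D.of D.a))
    (hx : ∀ g, dot D.x (D.of g) = (D.chi g : k) • D.x)
    (hx' : ∀ g, col D.x (D.of g) = (D.chi g : k) • D.x)
    (ha : ∀ g, d g D.a = g ∧ dot (D.of g) D.x = 0) : D.chi ^ 2 = 1 := by
  ext g
  have c1 := hb.cycle₁ D.x (D.of g) D.x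
  simp only [comulCop, comul_x, comul_of, LinearMap.comp_apply, LinearEquiv.coe_coe, map_add,
    lift.tmul, comm_tmul, LinearMap.compl₁₂_apply, hx, hx', hxx, h.dot_of, map_smul,
    LinearMap.smul_apply, (ha g).2, map_zero, zero_add, h.grp_one,
    h.one_sub_a_of] at c1
  rw [smul_smul, smul_smul] at c1
  have e := (D.smul_x_add_inj (c := 0) (c' := 0) (congrArg (fun z => (0 : k) • D.x + z) c1)).2
  rw [MonoidHom.pow_apply, Units.val_pow_eq_pow_val, MonoidHom.one_apply, Units.val_one]
  refine mul_right_cancel₀ hr ?_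
  linear_combination e

theorem isQBrace (h : Restricts D dot col d c) (hb : IsHopfQBrace dot col) : IsQBrace d c where
  left_regular := h.grp_bijective
  right_regular := h.swap.grp_bijective
  cycle₁ u v w := by
    have := hb.cycle₁ (D.of u) (D.of v) (D.of w)
    simp only [comulCop, comul_of, LinearMap.comp_apply, LinearEquiv.coe_coe,
      lift.tmul, comm_tmul, LinearMap.compl₁₂_apply, h.dot_of, h.col_of] at this
    exact D.of_injective this
  cycle₂ u v w := by
    have := hb.cycle₂ (D.of u) (D.of v) (D.of w)
    simp only [comulCop, comul_of, LinearMap.comp_apply, LinearEquiv.coe_coe,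
      lift.tmul, comm_tmul, LinearMap.compl₁₂_apply, h.dot_of, h.col_of] at this
    exact D.of_injective this
  cycle₃ u v w := by
    have := hb.cycle₃ (D.of u) (D.of v) (D.of w)
    simp only [comulCop, comul_of, LinearMap.comp_apply, LinearEquiv.coe_coe,
      lift.tmul, comm_tmul, LinearMap.compl₁₂_apply, h.dot_of, h.col_of] at this
    exact D.of_injective this
  dot_one := h.grp_one
  dot_mul := h.grp_mul
  col_one := h.swap.grp_one
  col_mul := h.swap.grp_mul
  mul_dot := h.grp_mul_dot
  mul_col := h.swap.grp_mul_dot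

/-- A Hopf `q`-brace structure on `H_D` with `x · x ≠ 0` and `x : x ≠ 0` has the given form. -/
theorem exists_formulas [CharZero k] (hb : IsHopfQBrace dot col) (h1 : dot D.x D.x ≠ 0)
    (h2 : col D.x D.x ≠ 0) : D.n = 2 ∧ ∃ dotG colG : G → G → G,
      (∀ h g, dot (D.of h) (D.of g) = D.of (dotG h g)) ∧
      (∀ h g, col (D.of h) (D.of g) = D.of (colG h g)) ∧
      IsQBrace dotG colG ∧
      (∀ g, dotG D.a g = D.a ∧ colG D.a g = D.a ∧ dotG g D.a = g ∧ colG g D.a = g) ∧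
      D.chi ^ 2 = 1 ∧
      (∀ h l, D.chi h * D.chi (colG l h) = D.chi l * D.chi (dotG h l)) ∧
      ∃ lam : k, lam ≠ 0 ∧ D.Formulas dotG colG lam dot col := by
  obtain ⟨d, c, h⟩ := exists_restricts hb.isPreBrace
  obtain ⟨hq, r, hr, hxx, hxx'⟩ := chi_a_and_scalars h hb h1 h2
  obtain ⟨_, _, _, hx0⟩ := h.exists_x_x h1
  obtain ⟨_, _, _, hx0'⟩ := h.swap.exists_x_x h2
  have hx := h.x_of hq hx0
  have hx' := h.swap.x_of hq hx0'
  have ha := h.grp_a_and_of_x hq hr hxx hxx' hx hx'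
  have hxxn : dot D.x D.x = -(-r) • (1 - D.of D.a) := by rw [neg_neg, hxx]
  have ha' := h.swap.grp_a_and_of_x hq (neg_ne_zero.2 hr) hxx' hxxn hx' hx
  have hchi := chi_sq h hb hr hxx hx hx' ha
  refine ⟨D.n_eq_two_of_chi_a hq, d, c, h.dot_of, h.col_of, isQBrace h hb,
    fun g => ⟨h.a_grp g, h.swap.a_grp g, (ha g).1, (ha' g).1⟩, hchi, fun g l => ?_, r, hr, ?_⟩
  · have e := h.chi_mul_chi hx ha' g l
    have hs : ∀ z, D.chi z * D.chi z = 1 := fun z => by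
      rw [← sq]; exact DFunLike.congr_fun hchi z
    -- The relation χ(g)χ(l) = χ(l:g)χ(g·l) becomes condition 2 because all values of χ have square
    -- 1.
    calc D.chi g * D.chi (c l g) =
        D.chi g * (D.chi (c l g) * D.chi (d g l)) * D.chi (d g l) := by
          rw [mul_assoc, mul_assoc, hs, mul_one]
      _ = (D.chi g * D.chi g) * (D.chi l * D.chi (d g l)) := by rw [← e]; simp only [mul_assoc]
      _ = _ := by rw [hs, one_mul]
  · exact
      { dot_of := h.dot_of
        col_of := h.col_of
        dot_x_of := h.of_mul_x_of_eq hx ha'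
        col_x_of := h.swap.of_mul_x_of_eq hx' ha
        dot_of_x := h.of_of_mul_x ha
        col_of_x := h.swap.of_of_mul_x ha'
        dot_x_x := h.of_mul_x_of_mul_x hxx hxx' hx' ha ha'
        col_x_x := fun g l => by
          rw [h.swap.of_mul_x_of_mul_x hxx' hxxn hx ha' ha, neg_smul] }

end RankOne.Datum
end

/-! ### The converse: compatible q-braces and the basis g, gx. -/

noncomputable section

theorem HopfQBrace.IsQBrace.swap {G : Type*} [Group G] {d c : G → G → G}
    (h : IsQBrace d c) : IsQBrace c d where
  left_regular := h.right_regular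
  right_regular := h.left_regular
  cycle₁ u v w := (h.cycle₃ u w v).symm
  cycle₂ u v w := (h.cycle₂ u w v).symm
  cycle₃ u v w := (h.cycle₁ u w v).symm
  dot_one := h.col_one
  dot_mul := h.col_mul
  col_one := h.dot_one
  col_mul := h.dot_mul
  mul_dot := h.mul_col
  mul_col := h.mul_dot

namespace RankOne.Datum

open HopfQBrace TensorProduct

universe u v
variable {k : Type u} {G : Type v} [Field k] [Group G]

/-- A `q`-brace structure on `G` compatible with the datum `D`. -/
structure IsCompatible (D : Datum k G) (d c : G → G → G) : Prop extends IsQBrace d c where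
  a_dot : ∀ g, d D.a g = D.a
  a_col : ∀ g, c D.a g = D.a
  dot_a : ∀ g, d g D.a = g
  col_a : ∀ g, c g D.a = g
  chi_mul_self : ∀ g, (D.chi g : k) * D.chi g = 1
  chi_col : ∀ h l, (D.chi (c l h) : k) = D.chi h * D.chi l * D.chi (d h l)

theorem Formulas.swap {D : Datum k G} {d c : G → G → G} {r : k} {dot col : D.H →ₗ[k] D.H →ₗ[k] D.H}
    (F : D.Formulas d c r dot col) : D.Formulas c d (-r) col dot where
  dot_of := F.col_of
  col_of := F.dot_of
  dot_x_of := F.col_x_of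
  col_x_of := F.dot_x_of
  dot_of_x := F.col_of_x
  col_of_x := F.dot_of_x
  dot_x_x h g := by rw [F.col_x_x, neg_smul]
  col_x_x h g := by rw [F.dot_x_x, neg_smul, neg_neg]

/-- The basis element `gx`. -/
def ofX (D : Datum k G) (g : G) : D.H := D.of g * D.x

section

variable (D : Datum k G)

theorem mul_a_mul (g h : G) : g * D.a * h = g * h * D.a := by
  rw [mul_assoc, ← D.mul_a, ← mul_assoc]

theorem comul_ofX (g : G) : Coalgebra.comul (R := k) (D.ofX g) =
    D.ofX g ⊗ₜ D.of (g * D.a) + D.of g ⊗ₜ D.ofX g := D.comul_of_mul_x g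

theorem counit_ofX (g : G) : Coalgebra.counit (R := k) (D.ofX g) = 0 := by
  rw [ofX, D.counit_eq, map_mul, counitHom_x, mul_zero]

theorem chi_mul (g h : G) : (D.chi (g * h) : k) = D.chi g * D.chi h := by
  rw [map_mul, Units.val_mul]

theorem of_mul_of (g h : G) : D.of g * D.of h = D.of (g * h) := (map_mul _ _ _).symm

theorem of_mul_ofX (g h : G) : D.of g * D.ofX h = D.ofX (g * h) := by
  rw [ofX, ofX, map_mul, mul_assoc]

theorem ofX_mul_of (g h : G) : D.ofX g * D.of h = (D.chi h : k) • D.ofX (g * h) := by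
  rw [ofX, ofX, map_mul, mul_assoc, x_mul, mul_smul_comm, mul_assoc]

variable {D}

theorem ofX_mul_ofX (hn : D.n = 2) (g h : G) : D.ofX g * D.ofX h =
    ((D.chi h : k) * D.alpha) • (D.of (g * h * D.a * D.a) - D.of (g * h)) := by
  rw [show D.ofX h = D.of h * D.x from rfl, ← mul_assoc, ofX_mul_of, ofX, smul_mul_assoc,
    mul_assoc, D.x_mul_x hn, mul_smul_comm, mul_sub, mul_one, smul_smul]
  simp only [map_mul, mul_assoc]

variable (D) in
/-- The basis of `H_D` in the case `n = 2`. -/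
def std : G ⊕ G → D.H := Sum.elim D.of D.ofX

@[simp]
theorem std_inl (g : G) : D.std (Sum.inl g) = D.of g := rfl

@[simp]
theorem std_inr (g : G) : D.std (Sum.inr g) = D.ofX g := rfl

theorem induction_std (hn : D.n = 2) {P : D.H → Prop} (add : ∀ y z, P y → P z → P (y + z))
    (smul : ∀ (s : k) y, P y → P (s • y)) (std : ∀ i, P (D.std i)) (y : D.H) : P y := by
  have h0 : P 0 := by simpa using smul 0 _ (std (Sum.inl 1))
  refine Submodule.span_induction ?_ h0 (fun y z _ _ => add y z) (fun s y _ => smul s y)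
    (D.span_of_mul_x_pow (Submodule.mem_top (x := y)))
  rintro _ ⟨⟨g, i, hi⟩, rfl⟩
  rcases (show i = 0 ∨ i = 1 by omega) with rfl | rfl
  · simpa using std (Sum.inl g)
  · have := std (Sum.inr g)
    rw [std_inr, ofX] at this
    simpa using this

/-- The identities in three variables are trilinear, so this reduces each of them to the eight types
of basis triples. -/
theorem induction_std₃ (hn : D.n = 2) {P : D.H → D.H → D.H → Prop}
    (add₁ : ∀ y y' z w, P y z w → P y' z w → P (y + y') z w)
    (add₂ : ∀ y z z' w, P y z w → P y z' w → P y (z + z') w)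
    (add₃ : ∀ y z w w', P y z w → P y z w' → P y z (w + w'))
    (smul₁ : ∀ (s : k) y z w, P y z w → P (s • y) z w)
    (smul₂ : ∀ (s : k) y z w, P y z w → P y (s • z) w)
    (smul₃ : ∀ (s : k) y z w, P y z w → P y z (s • w))
    (std : ∀ i j l, P (D.std i) (D.std j) (D.std l)) (y z w : D.H) : P y z w :=
  induction_std hn (fun y y' => add₁ y y' z w) (fun s y => smul₁ s y z w) (fun i =>
    induction_std hn (fun z z' => add₂ _ z z' w) (fun s z => smul₂ s _ z w) (fun j =>
      induction_std hn (fun w w' => add₃ _ _ w w') (fun s w => smul₃ s _ _ w) (fun l =>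
        std i j l) w) z) y

theorem hom_ext_std (hn : D.n = 2) {M : Type*} [AddCommGroup M] [Module k M]
    {f g : D.H →ₗ[k] M} (h : ∀ i, f (D.std i) = g (D.std i)) : f = g :=
  LinearMap.ext fun y => induction_std hn (P := fun y => f y = g y)
    (fun y z hy hz => by rw [map_add, map_add, hy, hz])
    (fun s y hy => by rw [map_smul, map_smul, hy]) h y

theorem hom_ext_std₂ (hn : D.n = 2) {M : Type*} [AddCommGroup M] [Module k M]
    {f g : D.H →ₗ[k] D.H →ₗ[k] M} (h : ∀ i j, f (D.std i) (D.std j) = g (D.std i) (D.std j)) :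
    f = g :=
  hom_ext_std hn fun i => hom_ext_std hn (h i)

theorem tensor_ext_std (hn : D.n = 2) {M : Type*} [AddCommGroup M] [Module k M]
    {f g : D.H ⊗[k] D.H →ₗ[k] M}
    (h : ∀ i j, f (D.std i ⊗ₜ D.std j) = g (D.std i ⊗ₜ D.std j)) : f = g :=
  TensorProduct.ext (hom_ext_std₂ hn h)

end

namespace IsCompatible

variable {D : Datum k G} {d c : G → G → G} (hc : IsCompatible D d c)
include hc

/-- From χ² = 1 and χ(a) ≠ 1; this is why the converse need not assume n = 2. -/
theorem chi_a : (D.chi D.a : k) = -1 :=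
  (eq_or_eq_neg_of_sq_eq_sq _ 1 (by rw [sq, hc.chi_mul_self, one_pow])).resolve_left
    D.chi_a_ne_one

theorem n_eq : D.n = 2 := D.n_eq_two_of_chi_a hc.chi_a

theorem swap : IsCompatible D c d where
  toIsQBrace := hc.toIsQBrace.swap
  a_dot := hc.a_col
  a_col := hc.a_dot
  dot_a := hc.col_a
  col_a := hc.dot_a
  chi_mul_self := hc.chi_mul_self
  chi_col h l := by
    rw [hc.chi_col]
    linear_combination (-(D.chi (d l h) : k) * D.chi l * D.chi l) * hc.chi_mul_self h
      - (D.chi (d l h) : k) * hc.chi_mul_self l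

theorem dot_mul_a (g h : G) : d g (h * D.a) = d g h := by
  rw [hc.dot_mul, hc.dot_a]

theorem mul_a_dot (g h : G) : d (g * D.a) h = d g h * D.a := by
  rw [hc.mul_dot, hc.col_a, hc.a_dot]

theorem chi_eq (g : G) : (D.chi g : k) = 1 ∨ (D.chi g : k) = -1 :=
  eq_or_eq_neg_of_sq_eq_sq _ 1 (by rw [sq, hc.chi_mul_self, one_pow])

end IsCompatible

section

variable {D : Datum k G} {d c : G → G → G} {r : k} {dot col : D.H →ₗ[k] D.H →ₗ[k] D.H}

namespace Formulas

variable (F : D.Formulas d c r dot col)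
include F

theorem ofX_of (g h : G) : dot (D.ofX g) (D.of h) = (D.chi h : k) • D.ofX (d g h) := F.dot_x_of g h

theorem of_ofX (g h : G) : dot (D.of g) (D.ofX h) = 0 := F.dot_of_x g h

theorem ofX_ofX (g h : G) :
    dot (D.ofX g) (D.ofX h) = r • (D.of (d g h) - D.of (d g h * D.a)) := by
  rw [ofX, ofX, F.dot_x_x, mul_sub, mul_one, map_mul]

end Formulas

end

end RankOne.Datum
end

/-! ### Verification of the Hopf q-brace identities on the basis. -/

noncomputable section
namespace RankOne.Datum

open HopfQBrace TensorProduct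

section

variable {R M N : Type*} [CommRing R] [AddCommGroup M] [Module R M] [AddCommGroup N] [Module R N]
  (f : M →ₗ[R] M →ₗ[R] N) (g g' h h' : M →ₗ[R] M) (s : R) (t : M ⊗[R] M)

theorem lift_compl_add_left : TensorProduct.lift (f.compl₁₂ (g + g') h) t =
    TensorProduct.lift (f.compl₁₂ g h) t + TensorProduct.lift (f.compl₁₂ g' h) t := by
  rw [← LinearMap.add_apply]
  congr 1
  ext
  simp

theorem lift_compl_add_right : TensorProduct.lift (f.compl₁₂ g (h + h')) t =
    TensorProduct.lift (f.compl₁₂ g h) t + TensorProduct.lift (f.compl₁₂ g h') t := by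
  rw [← LinearMap.add_apply]
  congr 1
  ext
  simp

theorem lift_compl_smul_left : TensorProduct.lift (f.compl₁₂ (s • g) h) t =
    s • TensorProduct.lift (f.compl₁₂ g h) t := by
  rw [← LinearMap.smul_apply]
  congr 1
  ext
  simp

theorem lift_compl_smul_right : TensorProduct.lift (f.compl₁₂ g (s • h)) t =
    s • TensorProduct.lift (f.compl₁₂ g h) t := by
  rw [← LinearMap.smul_apply]
  congr 1
  ext
  simp

end

universe u v
variable {k : Type u} {G : Type v} [Field k] [Group G]
variable {D : Datum k G} {d c : G → G → G} {r : k} {dot col : D.H →ₗ[k] D.H →ₗ[k] D.H}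

namespace Formulas

variable (F : D.Formulas d c r dot col) (hc : IsCompatible D d c)
include F hc

set_option linter.unusedSimpArgs false

theorem isHopfQBrace_dot_one (y : D.H) : dot y 1 = y := by
  rw [← map_one D.of, ← LinearMap.flip_apply]
  refine LinearMap.congr_fun (hom_ext_std hc.n_eq (g := LinearMap.id) ?_) y
  rintro (g | g) <;>
  simp only [std_inl, std_inr, LinearMap.flip_apply, LinearMap.id_apply, F.dot_of, F.ofX_of,
    hc.dot_one, map_one D.chi, Units.val_one, one_smul]

theorem isHopfQBrace_dot_mul (y z w : D.H) : dot y (z * w) = dot (dot y w) z := by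
  induction y, z, w using induction_std₃ hc.n_eq with
  | add₁ _ _ _ _ h h' | add₂ _ _ _ _ h h' | add₃ _ _ _ _ h h' =>
    simp only [map_add, add_mul, mul_add, LinearMap.add_apply, h, h']
  | smul₁ _ _ _ _ h | smul₂ _ _ _ _ h | smul₃ _ _ _ _ h =>
    simp only [map_smul, smul_mul_assoc, mul_smul_comm, LinearMap.smul_apply, h]
  | std i j l =>
    rcases i with g | g <;> rcases j with p | p <;> rcases l with q | q <;>
    simp only [std_inl, std_inr] <;>
    simp only [of_mul_of, of_mul_ofX, ofX_mul_of, ofX_mul_ofX hc.n_eq, F.dot_of, F.ofX_of,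
      F.of_ofX, F.ofX_ofX, hc.dot_mul, hc.dot_a, hc.mul_a_dot, map_smul, map_sub, map_zero,
      LinearMap.smul_apply, LinearMap.sub_apply, LinearMap.zero_apply, smul_zero, sub_self,
      chi_mul, hc.chi_a] <;>
    module

theorem isHopfQBrace_cycle₁ (u v w : D.H) :
    TensorProduct.lift (dot.compl₁₂ (dot u) (col w)) (Coalgebra.comul v) =
    TensorProduct.lift (dot.compl₁₂ (dot u) (dot v)) (comulCop k D.H w) := by
  induction u, v, w using induction_std₃ hc.n_eq with
  | add₁ _ _ _ _ h h' | add₂ _ _ _ _ h h' | add₃ _ _ _ _ h h' =>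
    simp only [map_add, lift_compl_add_left, lift_compl_add_right, LinearMap.add_apply, h, h']
  | smul₁ _ _ _ _ h | smul₂ _ _ _ _ h | smul₃ _ _ _ _ h =>
    simp only [map_smul, lift_compl_smul_left, lift_compl_smul_right, LinearMap.smul_apply, h]
  | std i j l =>
    rcases i with g | g <;> rcases j with p | p <;> rcases l with q | q <;>
    simp only [std_inl, std_inr] <;>
    simp only [comulCop, comul_of, comul_ofX, LinearMap.comp_apply, LinearEquiv.coe_coe, map_add,
      lift.tmul, comm_tmul, LinearMap.compl₁₂_apply, F.dot_of, F.col_of, F.ofX_of, F.of_ofX,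
      F.ofX_ofX, F.swap.ofX_of, F.swap.of_ofX, F.swap.ofX_ofX, map_smul, map_sub, map_zero,
      LinearMap.smul_apply, LinearMap.sub_apply, LinearMap.zero_apply, hc.dot_mul_a,
      hc.swap.dot_mul_a, hc.mul_a_dot, hc.swap.mul_a_dot, hc.dot_a, hc.col_a, hc.cycle₁, hc.cycle₂,
      hc.cycle₃, smul_zero, sub_self, add_zero, zero_add, chi_mul, hc.chi_col] <;>
    -- After the q-brace identities in G, the two sides differ only by products of character values.
    -- These values are ±1, so fixing the signs reduces the claim to linear algebra over k.
    rcases hc.chi_eq p with e | e <;> rcases hc.chi_eq q with e' | e' <;>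
    simp only [e, e', hc.chi_a] <;> module

theorem isHopfQBrace_cycle₂ (u v w : D.H) :
    TensorProduct.lift (col.compl₁₂ (dot u) (dot w)) (Coalgebra.comul v) =
    TensorProduct.lift (dot.compl₁₂ (col u) (col v)) (comulCop k D.H w) := by
  induction u, v, w using induction_std₃ hc.n_eq with
  | add₁ _ _ _ _ h h' | add₂ _ _ _ _ h h' | add₃ _ _ _ _ h h' =>
    simp only [map_add, lift_compl_add_left, lift_compl_add_right, LinearMap.add_apply, h, h']
  | smul₁ _ _ _ _ h | smul₂ _ _ _ _ h | smul₃ _ _ _ _ h =>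
    simp only [map_smul, lift_compl_smul_left, lift_compl_smul_right, LinearMap.smul_apply, h]
  | std i j l =>
    rcases i with g | g <;> rcases j with p | p <;> rcases l with q | q <;>
    simp only [std_inl, std_inr] <;>
    simp only [comulCop, comul_of, comul_ofX, LinearMap.comp_apply, LinearEquiv.coe_coe, map_add,
      lift.tmul, comm_tmul, LinearMap.compl₁₂_apply, F.dot_of, F.col_of, F.ofX_of, F.of_ofX,
      F.ofX_ofX, F.swap.ofX_of, F.swap.of_ofX, F.swap.ofX_ofX, map_smul, map_sub, map_zero,
      LinearMap.smul_apply, LinearMap.sub_apply, LinearMap.zero_apply, hc.dot_mul_a,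
      hc.swap.dot_mul_a, hc.mul_a_dot, hc.swap.mul_a_dot, hc.dot_a, hc.col_a, hc.cycle₁, hc.cycle₂,
      hc.cycle₃, smul_zero, sub_self, add_zero, zero_add, chi_mul, hc.chi_col] <;>
    rcases hc.chi_eq p with e | e <;> rcases hc.chi_eq q with e' | e' <;>
    simp only [e, e', hc.chi_a] <;> module

theorem isHopfQBrace_cycle₃ (u v w : D.H) :
    TensorProduct.lift (col.compl₁₂ (col u) (col w)) (Coalgebra.comul v) =
    TensorProduct.lift (col.compl₁₂ (col u) (dot v)) (comulCop k D.H w) := by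
  induction u, v, w using induction_std₃ hc.n_eq with
  | add₁ _ _ _ _ h h' | add₂ _ _ _ _ h h' | add₃ _ _ _ _ h h' =>
    simp only [map_add, lift_compl_add_left, lift_compl_add_right, LinearMap.add_apply, h, h']
  | smul₁ _ _ _ _ h | smul₂ _ _ _ _ h | smul₃ _ _ _ _ h =>
    simp only [map_smul, lift_compl_smul_left, lift_compl_smul_right, LinearMap.smul_apply, h]
  | std i j l =>
    rcases i with g | g <;> rcases j with p | p <;> rcases l with q | q <;>
    simp only [std_inl, std_inr] <;>
    simp only [comulCop, comul_of, comul_ofX, LinearMap.comp_apply, LinearEquiv.coe_coe, map_add,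
      lift.tmul, comm_tmul, LinearMap.compl₁₂_apply, F.dot_of, F.col_of, F.ofX_of, F.of_ofX,
      F.ofX_ofX, F.swap.ofX_of, F.swap.of_ofX, F.swap.ofX_ofX, map_smul, map_sub, map_zero,
      LinearMap.smul_apply, LinearMap.sub_apply, LinearMap.zero_apply, hc.dot_mul_a,
      hc.swap.dot_mul_a, hc.mul_a_dot, hc.swap.mul_a_dot, hc.dot_a, hc.col_a, hc.cycle₁, hc.cycle₂,
      hc.cycle₃, smul_zero, sub_self, add_zero, zero_add, chi_mul, hc.chi_col] <;>
    rcases hc.chi_eq p with e | e <;> rcases hc.chi_eq q with e' | e' <;>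
    simp only [e, e', hc.chi_a] <;> module

theorem isHopfQBrace_mul_dot (y z w : D.H) : dot (y * z) w =
    TensorProduct.lift ((LinearMap.mul k D.H).compl₁₂ (dot y) LinearMap.id)
      (hMap dot col (z ⊗ₜ w)) := by
  induction y, z, w using induction_std₃ hc.n_eq with
  | add₁ _ _ _ _ h h' | add₂ _ _ _ _ h h' | add₃ _ _ _ _ h h' =>
    simp only [map_add, add_mul, mul_add, tmul_add, add_tmul, lift_compl_add_left,
      LinearMap.add_apply, h, h']
  | smul₁ _ _ _ _ h | smul₂ _ _ _ _ h | smul₃ _ _ _ _ h =>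
    simp only [map_smul, smul_mul_assoc, mul_smul_comm, tmul_smul, smul_tmul,
      lift_compl_smul_left, LinearMap.smul_apply, h]
  | std i j l =>
    rcases i with g | g <;> rcases j with p | p <;> rcases l with q | q <;>
    simp only [std_inl, std_inr]
    all_goals simp only [hMap, comulTensor, comulCop, comul_of, comul_ofX, LinearMap.comp_apply,
      map_tmul, LinearEquiv.coe_coe, tmul_add, add_tmul, map_add, tensorTensorTensorComm_tmul,
      lift.tmul,
      comm_tmul, LinearMap.compl₁₂_apply, LinearMap.flip_apply, LinearMap.mul_apply',
      LinearMap.id_apply, of_mul_of, of_mul_ofX, ofX_mul_of, ofX_mul_ofX hc.n_eq, F.dot_of,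
      F.col_of, F.ofX_of, F.of_ofX, F.ofX_ofX, F.swap.ofX_of, F.swap.of_ofX, F.swap.ofX_ofX,
      hc.dot_mul_a, hc.mul_a_dot, hc.swap.dot_mul_a, hc.swap.mul_a_dot, hc.mul_dot, map_smul,
      map_sub, map_zero, LinearMap.smul_apply, LinearMap.sub_apply, LinearMap.zero_apply, smul_zero,
      sub_self, mul_sub, sub_mul, smul_mul_assoc, mul_smul_comm, mul_zero, zero_mul, tmul_zero,
      zero_tmul, add_zero, zero_add, chi_mul, hc.chi_a, hc.chi_col, ← mul_assoc,
      -- Moves the central a to the right end of each group word. Only the right factor `d p q` is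
      -- allowed, which keeps the rule from matching words such as z * a * a.
      fun z => D.mul_a_mul z (d p q)]
    all_goals
      rcases hc.chi_eq p with e | e <;> rcases hc.chi_eq q with e' | e' <;>
      rcases hc.chi_eq (d p q) with e'' | e'' <;>
      simp only [e, e', e''] <;> module

theorem isHopfQBrace_counit_dot (y z : D.H) : Coalgebra.counit (R := k) (dot y z) =
    Coalgebra.counit (R := k) y * Coalgebra.counit (R := k) z := by
  have key : dot.compr₂ Coalgebra.counit = (LinearMap.mul k k).compl₁₂ (Coalgebra.counit (A := D.H))
      (Coalgebra.counit (A := D.H)) := by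
    refine hom_ext_std₂ hc.n_eq ?_
    rintro (g | g) (p | p) <;> simp only [std_inl, std_inr] <;>
    simp only [LinearMap.compr₂_apply, LinearMap.compl₁₂_apply, F.dot_of, F.ofX_of, F.of_ofX,
      F.ofX_ofX, counit_of, counit_ofX, map_smul, map_sub, map_zero, LinearMap.mul_apply',
      smul_zero, sub_self, mul_zero, zero_mul, mul_one, LinearMap.zero_apply]
  exact LinearMap.congr_fun₂ key y z

theorem isHopfQBrace_counit_hMap :
    counitTensor k D.H ∘ₗ hMap dot col = counitTensor k D.H := by
  refine tensor_ext_std hc.n_eq ?_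
  rintro (g | g) (p | p) <;> simp only [std_inl, std_inr] <;>
  simp only [hMap, comulTensor, comulCop, comul_of, comul_ofX, LinearMap.comp_apply, map_tmul,
    LinearEquiv.coe_coe, tmul_add, add_tmul, map_add, tensorTensorTensorComm_tmul, lift.tmul,
    comm_tmul, LinearMap.flip_apply, F.dot_of, F.col_of, F.ofX_of, F.of_ofX, F.ofX_ofX,
    F.swap.ofX_of, F.swap.of_ofX, F.swap.ofX_ofX, counitTensor_tmul, counit_of, counit_ofX,
    map_smul, map_sub, smul_zero, sub_self, mul_zero, zero_mul, tmul_zero, zero_tmul, map_zero,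
    add_zero]

theorem isHopfQBrace_comul_hMap :
    comulTensor (comulCop k D.H) (Coalgebra.comul (R := k)) ∘ₗ hMap dot col =
    TensorProduct.map (hMap dot col) (hMap dot col) ∘ₗ
      comulTensor (Coalgebra.comul (R := k)) (comulCop k D.H) := by
  refine tensor_ext_std (M := (D.H ⊗[k] D.H) ⊗[k] (D.H ⊗[k] D.H)) hc.n_eq ?_
  rintro (g | g) (p | p) <;> simp only [std_inl, std_inr] <;>
  simp only [hMap, comulTensor, comulCop, comul_of, comul_ofX, LinearMap.comp_apply, map_tmul,
    LinearEquiv.coe_coe, tmul_add, add_tmul, map_add, tensorTensorTensorComm_tmul, lift.tmul,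
    comm_tmul, LinearMap.flip_apply, F.dot_of, F.col_of, F.ofX_of, F.of_ofX, F.ofX_ofX,
    F.swap.ofX_of, F.swap.of_ofX, F.swap.ofX_ofX, hc.dot_mul_a, hc.mul_a_dot, hc.swap.dot_mul_a,
    hc.swap.mul_a_dot, map_smul, map_sub, smul_zero, sub_self, tmul_zero, zero_tmul, map_zero,
    add_zero, zero_add, tmul_sub, sub_tmul, tmul_smul, ← smul_tmul', chi_mul, hc.chi_a, hc.chi_col]
  all_goals module

end Formulas
end RankOne.Datum
end

/-! ### Regularity, uniqueness and existence. -/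

noncomputable section
namespace RankOne.Datum

open HopfQBrace TensorProduct

universe u v
variable {k : Type u} {G : Type v} [Field k] [Group G]
variable {D : Datum k G} {d c : G → G → G} {r : k} {dot col : D.H →ₗ[k] D.H →ₗ[k] D.H}

theorem finite_H [Finite G] (D : Datum k G) : Module.Finite k D.H :=
  Module.Finite.of_basis D.basis

theorem eq_top_of_std (hn : D.n = 2) (S : Submodule k (D.H ⊗[k] D.H))
    (h : ∀ i j, D.std i ⊗ₜ[k] D.std j ∈ S) : S = ⊤ := by
  refine (Submodule.eq_top_iff').2 fun t => ?_
  induction t with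
  | zero => exact S.zero_mem
  | add t t' ht ht' => exact S.add_mem ht ht'
  | tmul y z =>
    refine induction_std hn (P := fun y => y ⊗ₜ[k] z ∈ S) ?_ ?_ (fun i => ?_) y
    · intro y y' hy hy'
      rw [add_tmul]
      exact S.add_mem hy hy'
    · intro s y hy
      rw [← smul_tmul']
      exact S.smul_mem s hy
    · refine induction_std hn (P := fun z => D.std i ⊗ₜ[k] z ∈ S) ?_ ?_ (h i) z
      · intro y y' hy hy'
        rw [tmul_add]
        exact S.add_mem hy hy'
      · intro s y hy
        rw [tmul_smul]
        exact S.smul_mem s hy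

namespace Formulas

variable (F : D.Formulas d c r dot col) (hc : IsCompatible D d c)
include F hc

/-- In finite dimension surjectivity suffices. The permutations of G given by · yield all g ⊗ l, g ⊗
lx and gx ⊗ l, and the image of gx ⊗ lx has the required leading term modulo tensors of elements of
G. The parameters δ, s and t cover both Δ, for left regularity, and its co-opposite, for right
regularity. -/
theorem bijective_gMap [Finite G] (δ : D.H →ₗ[k] D.H ⊗[k] D.H) (s t : G → G)
    (h1 : ∀ g, δ (D.of g) = D.of g ⊗ₜ D.of g)
    (h2 : ∀ g, δ (D.ofX g) = D.ofX g ⊗ₜ D.of (s g) + D.of (t g) ⊗ₜ D.ofX g) :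
    Function.Bijective (gMap δ dot) := by
  have := finite_H D
  have hsurj : Function.Surjective (gMap δ dot) := by
    rw [← LinearMap.range_eq_top]
    set S := LinearMap.range (gMap δ dot) with hS
    have e1 : ∀ y l, gMap δ dot (y ⊗ₜ D.of l) = dot y (D.of l) ⊗ₜ D.of l := fun y l => by
      simp [gMap, h1]
    have e2 : ∀ y l, gMap δ dot (y ⊗ₜ D.ofX l) =
        dot y (D.ofX l) ⊗ₜ D.of (s l) + dot y (D.of (t l)) ⊗ₜ D.ofX l := fun y l => by
      simp [gMap, h2, tmul_add]
    have hmem : ∀ y, gMap δ dot y ∈ S := fun y => LinearMap.mem_range_self _ y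
    have m1 : ∀ g l, D.of g ⊗ₜ[k] D.of l ∈ S := fun g l => by
      obtain ⟨g, rfl⟩ := (hc.left_regular l).2 g
      have := hmem (D.of g ⊗ₜ D.of l)
      rwa [e1, F.dot_of] at this
    refine eq_top_of_std hc.n_eq S ?_
    rintro (g | g) (l | l) <;> simp only [std_inl, std_inr]
    · exact m1 g l
    · obtain ⟨g, rfl⟩ := (hc.left_regular (t l)).2 g
      have := hmem (D.of g ⊗ₜ D.ofX l)
      rwa [e2, F.dot_of, F.of_ofX, zero_tmul, zero_add] at this
    · obtain ⟨g, rfl⟩ := (hc.left_regular l).2 g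
      have := hmem (D.ofX g ⊗ₜ D.of l)
      rw [e1, F.ofX_of, ← smul_tmul'] at this
      exact (S.smul_mem_iff (D.chi l).ne_zero).1 this
    · obtain ⟨g, rfl⟩ := (hc.left_regular (t l)).2 g
      have := hmem (D.ofX g ⊗ₜ D.ofX l)
      rw [e2, F.ofX_of, F.ofX_ofX, ← smul_tmul', ← smul_tmul', sub_tmul] at this
      exact (S.smul_mem_iff (D.chi (t l)).ne_zero).1
        ((S.add_mem_iff_right (S.smul_mem _ (S.sub_mem (m1 _ _) (m1 _ _)))).1 this)
  exact ⟨LinearMap.injective_iff_surjective.2 hsurj, hsurj⟩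

theorem isHopfQBrace [Finite G] : IsHopfQBrace dot col where
  counit_dot := F.isHopfQBrace_counit_dot hc
  counit_col := F.swap.isHopfQBrace_counit_dot hc.swap
  counit_hMap := F.isHopfQBrace_counit_hMap hc
  comul_hMap := F.isHopfQBrace_comul_hMap hc
  left_regular := F.bijective_gMap hc _ (fun l => l * D.a) (fun l => l) D.comul_of D.comul_ofX
  right_regular := F.swap.bijective_gMap hc.swap _ (fun l => l) (fun l => l * D.a)
    (fun g => by simp [comulCop, comul_of])
    (fun g => by simp [comulCop, comul_ofX, add_comm])
  cycle₁ := F.isHopfQBrace_cycle₁ hc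
  cycle₂ := F.isHopfQBrace_cycle₂ hc
  cycle₃ := F.isHopfQBrace_cycle₃ hc
  dot_one := F.isHopfQBrace_dot_one hc
  dot_mul := F.isHopfQBrace_dot_mul hc
  col_one := F.swap.isHopfQBrace_dot_one hc.swap
  col_mul := F.swap.isHopfQBrace_dot_mul hc.swap
  mul_dot := F.isHopfQBrace_mul_dot hc
  mul_col := F.swap.isHopfQBrace_mul_dot hc.swap

theorem dot_unique {dot' col' : D.H →ₗ[k] D.H →ₗ[k] D.H} (F' : D.Formulas d c r dot' col') :
    dot' = dot := by
  refine hom_ext_std₂ hc.n_eq ?_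
  rintro (g | g) (l | l) <;> simp only [std_inl, std_inr]
  · rw [F.dot_of, F'.dot_of]
  · rw [F.of_ofX, F'.of_ofX]
  · rw [F.ofX_of, F'.ofX_of]
  · rw [F.ofX_ofX, F'.ofX_ofX]

end Formulas

/-- The operation on `H_D` defined by the formulas of `Formulas` in terms of the basis. -/
def opOfGroup (D : Datum k G) (d : G → G → G) (r : k) : D.H →ₗ[k] D.H →ₗ[k] D.H :=
  D.basis.constr k fun p => D.basis.constr k fun q =>
    -- Only exponents 0 and 1 matter to `Formulas`; the values at higher exponents are a convenient
    -- choice and disappear when n = 2.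
    if (q.2 : ℕ) = 0 then (D.chi q.1 : k) ^ (p.2 : ℕ) • (D.of (d p.1 q.1) * D.x ^ (p.2 : ℕ))
    else if (p.2 : ℕ) = 0 then 0 else r • (D.of (d p.1 q.1) * (1 - D.of D.a))

theorem opOfGroup_basis (d : G → G → G) (r : k) (g l : G) (i j : ℕ) (hi : i < D.n) (hj : j < D.n) :
    D.opOfGroup d r (D.of g * D.x ^ i) (D.of l * D.x ^ j) =
      if j = 0 then (D.chi l : k) ^ i • (D.of (d g l) * D.x ^ i)
      else if i = 0 then 0 else r • (D.of (d g l) * (1 - D.of D.a)) := by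
  rw [← D.basis_apply (g, ⟨i, hi⟩), ← D.basis_apply (l, ⟨j, hj⟩), opOfGroup,
    Module.Basis.constr_basis, Module.Basis.constr_basis]

theorem formulas_opOfGroup (D : Datum k G) (d c : G → G → G) (r : k) :
    D.Formulas d c r (D.opOfGroup d r) (D.opOfGroup c (-r)) where
  dot_of g l := by simpa using opOfGroup_basis d r g l 0 0 D.n_pos D.n_pos
  col_of g l := by simpa using opOfGroup_basis c (-r) g l 0 0 D.n_pos D.n_pos
  dot_x_of g l := by simpa using opOfGroup_basis d r g l 1 0 D.one_lt_n D.n_pos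
  col_x_of g l := by simpa using opOfGroup_basis c (-r) g l 1 0 D.one_lt_n D.n_pos
  dot_of_x g l := by simpa using opOfGroup_basis d r g l 0 1 D.n_pos D.one_lt_n
  col_of_x g l := by simpa using opOfGroup_basis c (-r) g l 0 1 D.n_pos D.one_lt_n
  dot_x_x g l := by simpa using opOfGroup_basis d r g l 1 1 D.one_lt_n D.one_lt_n
  col_x_x g l := by simpa using opOfGroup_basis c (-r) g l 1 1 D.one_lt_n D.one_lt_n

/-- The conditions on χ are restated in k, and condition 2 is solved for χ(l:h), so that it can
serve as a rewrite rule. -/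
theorem isCompatible_of (hb : IsQBrace d c)
    (ha : ∀ g, d D.a g = D.a ∧ c D.a g = D.a ∧ d g D.a = g ∧ c g D.a = g) (hchi : D.chi ^ 2 = 1)
    (hdc : ∀ h l, D.chi h * D.chi (c l h) = D.chi l * D.chi (d h l)) : IsCompatible D d c := by
  have hs : ∀ z, D.chi z * D.chi z = 1 := fun z => by
    rw [← sq]; exact DFunLike.congr_fun hchi z
  exact
    { toIsQBrace := hb
      a_dot := fun g => (ha g).1
      a_col := fun g => (ha g).2.1
      dot_a := fun g => (ha g).2.2.1
      col_a := fun g => (ha g).2.2.2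
      chi_mul_self := fun g => by rw [← Units.val_mul, hs, Units.val_one]
      chi_col := fun h l => by
        rw [← Units.val_mul, ← Units.val_mul, mul_assoc, ← hdc, ← mul_assoc, hs, one_mul] }

end RankOne.Datum
end

theorem theorem3p9 {k G : Type*} [Field k] [IsAlgClosed k] [CharZero k] [Group G] [Finite G]
    (D : RankOne.Datum k G) :
    (∀ dot col : D.H →ₗ[k] D.H →ₗ[k] D.H, HopfQBrace.IsHopfQBrace dot col →
      dot D.x D.x ≠ 0 → col D.x D.x ≠ 0 →
        D.n = 2 ∧
        ∃ dotG colG : G → G → G,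
          (∀ h g, dot (D.of h) (D.of g) = D.of (dotG h g)) ∧
          (∀ h g, col (D.of h) (D.of g) = D.of (colG h g)) ∧
          HopfQBrace.IsQBrace dotG colG ∧
          (∀ g, dotG D.a g = D.a ∧ colG D.a g = D.a ∧ dotG g D.a = g ∧ colG g D.a = g) ∧
          D.chi ^ 2 = 1 ∧
          (∀ h l, D.chi h * D.chi (colG l h) = D.chi l * D.chi (dotG h l)) ∧
          ∃ lam : k, lam ≠ 0 ∧ D.Formulas dotG colG lam dot col) ∧
    (∀ dotG colG : G → G → G, HopfQBrace.IsQBrace dotG colG →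
      (∀ g, dotG D.a g = D.a ∧ colG D.a g = D.a ∧ dotG g D.a = g ∧ colG g D.a = g) →
      D.chi ^ 2 = 1 →
      (∀ h l, D.chi h * D.chi (colG l h) = D.chi l * D.chi (dotG h l)) →
      ∀ lam : k, lam ≠ 0 →
        ∃ dot col : D.H →ₗ[k] D.H →ₗ[k] D.H,
          D.Formulas dotG colG lam dot col ∧ HopfQBrace.IsHopfQBrace dot col ∧
          ∀ dot' col' : D.H →ₗ[k] D.H →ₗ[k] D.H, D.Formulas dotG colG lam dot' col' →
            dot' = dot ∧ col' = col) := by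
  refine ⟨fun dot col hb h1 h2 => RankOne.Datum.exists_formulas hb h1 h2,
    fun d c hb ha hchi hdc r _ => ?_⟩
  have hc := RankOne.Datum.isCompatible_of hb ha hchi hdc
  have F := D.formulas_opOfGroup d c r
  exact ⟨_, _, F, F.isHopfQBrace hc, fun dot' col' F' =>
    -- Uniqueness of : is that of · for the exchanged operations with parameter -r.
    ⟨F.dot_unique hc F', F.swap.dot_unique hc.swap F'.swap⟩⟩
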